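/- Let $\mathfrak g$ be a finite-dimensional complex semisimple Lie algebra with a Cartan subalgebra $\mathfrak h$, a set of simple roots and the resulting set $P^+$ of dominant integral weights, and let $V(\mu)$ denote the finite-dimensional simple $\mathfrak g$-module of highest weight $\mu\in P^+$. Let $V$ be a finite-dimensional $\mathfrak g$-module and let $\mathfrak a=\mathfrak g\ltimes V$ be the semidirect product in which $V$ is an abelian ideal, graded with $\mathfrak g$ in degree $0$ and $V$ in degree $1$. Let $\widehat{\mathcal G}$ be the abelian category of $\mathbb Z$-graded $\mathfrak a$-modules $M=\bigoplus_{k\in\mathbb Z}M[k]$ with $\mathfrak a_n M[k]\subseteq M[k+n]$ and $\dim M[k]<\infty$ for all $k$, whose morphisms are the $\mathfrak a$-module maps of degree $0$. For $\mu\in P^+$ and $r\in\mathbb Z$ let $V(\mu,r)\in\widehat{\mathcal G}$ be the module $V(\mu)$ placed in degree $r$, on which $V$ acts by zero. Then for all integers $j\ge 0$, all $\mu,\nu\in P^+$ and all $r,s\in\mathbb Z$ there is an isomorphism of complex vector spaces $$\operatorname{Ext}^j_{\widehat{\mathcal G}}(V(\mu,r),V(\nu,s))\cong\begin{cases}\operatorname{Hom}_{\mathfrak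 g}(\wedge^j V\otimes V(\mu),V(\nu)) & \text{if } j=s-r,\\ 0 & \text{otherwise.}\end{cases}$$ -/

import Mathlib

open scoped TensorProduct
open CategoryTheory

universe u

section ExteriorPower

variable {M : Type*} [AddCommGroup M] [Module ℂ M]

/-- The multilinear map `(v₁, …, vₙ) ↦ ∑ᵢ v₁ ∧ ⋯ ∧ f vᵢ ∧ ⋯ ∧ vₙ`. -/
noncomputable def wedgeDerivMultilinear (n : ℕ) (f : Module.End ℂ M) :
    MultilinearMap ℂ (fun _ : Fin n => M) (⋀[ℂ]^n M) :=
  ∑ i : Fin n, (exteriorPower.ιMulti ℂ n (M := M)).toMultilinearMap.compLinearMap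
    (Function.update (fun _ => LinearMap.id) i f)

theorem wedgeDerivMultilinear_apply (n : ℕ) (f : Module.End ℂ M) (v : Fin n → M) :
    wedgeDerivMultilinear n f v =
      ∑ i : Fin n, exteriorPower.ιMulti ℂ n (Function.update v i (f (v i))) := by
  simp only [wedgeDerivMultilinear, sum_apply, MultilinearMap.compLinearMap_apply,
    AlternatingMap.coe_multilinearMap]
  refine Finset.sum_congr rfl fun i _ => ?_
  congr 1
  funext k
  by_cases h : k = i
  · subst h; simp
  · simp [h]

theorem wedgeDerivMultilinear_eq_zero (n : ℕ) (f : Module.End ℂ M) (v : Fin n → M)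
    (a b : Fin n) (hv : v a = v b) (hab : a ≠ b) : wedgeDerivMultilinear n f v = 0 := by
  rw [wedgeDerivMultilinear_apply, ← Finset.add_sum_erase _ _ (Finset.mem_univ a),
    ← Finset.add_sum_erase _ _ (show b ∈ Finset.univ.erase a by simp [hab.symm]), ← add_assoc,
    Finset.sum_eq_zero, add_zero]
  · have h : Function.update v b (f (v b)) =
        Function.update v a (f (v a)) ∘ Equiv.swap a b := by
      funext k
      by_cases hk : k = b
      · subst hk; simp [hv]
      · by_cases hk' : k = a
        · subst hk'; simp [hv, hab, hab.symm]
        · simp [Equiv.swap_apply_of_ne_of_ne hk' hk, hk, hk']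
    rw [h, AlternatingMap.map_swap _ _ hab, add_neg_cancel]
  · intro i hi
    simp only [Finset.mem_erase, Finset.mem_univ, and_true] at hi
    exact AlternatingMap.map_eq_zero_of_eq _ _ (by simp [hi.1.symm, hi.2.symm, hv]) hab

/-- The endomorphism of `⋀ⁿ M` induced by an endomorphism `f` of `M`, acting as a derivation:
`v₁ ∧ ⋯ ∧ vₙ ↦ ∑ᵢ v₁ ∧ ⋯ ∧ f vᵢ ∧ ⋯ ∧ vₙ`. -/
noncomputable def wedgeDeriv (n : ℕ) (f : Module.End ℂ M) : Module.End ℂ (⋀[ℂ]^n M) :=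
  exteriorPower.alternatingMapLinearEquiv
    { wedgeDerivMultilinear n f with
      map_eq_zero_of_eq' := fun v a b hv hab =>
        wedgeDerivMultilinear_eq_zero n f v a b hv hab }

theorem wedgeDeriv_ιMulti (n : ℕ) (f : Module.End ℂ M) (v : Fin n → M) :
    wedgeDeriv n f (exteriorPower.ιMulti ℂ n v) =
      ∑ i : Fin n, exteriorPower.ιMulti ℂ n (Function.update v i (f (v i))) := by
  rw [wedgeDeriv, exteriorPower.alternatingMapLinearEquiv_apply_ιMulti]
  exact wedgeDerivMultilinear_apply n f v

theorem wedgeDeriv_add (n : ℕ) (f g : Module.End ℂ M) :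
    wedgeDeriv n (f + g) = wedgeDeriv n f + wedgeDeriv n g := by
  apply exteriorPower.linearMap_ext
  ext1 v
  simp [wedgeDeriv_ιMulti, Finset.sum_add_distrib]

theorem wedgeDeriv_smul (n : ℕ) (c : ℂ) (f : Module.End ℂ M) :
    wedgeDeriv n (c • f) = c • wedgeDeriv n f := by
  apply exteriorPower.linearMap_ext
  ext1 v
  simp [wedgeDeriv_ιMulti, Finset.smul_sum]

theorem wedgeDeriv_lie (n : ℕ) (f g : Module.End ℂ M) (x : ⋀[ℂ]^n M) :
    wedgeDeriv n (f * g - g * f) x =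
      wedgeDeriv n f (wedgeDeriv n g x) - wedgeDeriv n g (wedgeDeriv n f x) := by
  have key : ∀ (f g : Module.End ℂ M) (v : Fin n → M),
      wedgeDeriv n f (wedgeDeriv n g (exteriorPower.ιMulti ℂ n v)) =
        (∑ i, exteriorPower.ιMulti ℂ n (Function.update v i (f (g (v i))))) +
        ∑ i, ∑ j, if i = j then 0 else exteriorPower.ιMulti ℂ n
          (Function.update (Function.update v i (g (v i))) j (f (v j))) := by
    intro f g v
    rw [wedgeDeriv_ιMulti, map_sum, ← Finset.sum_add_distrib]
    refine Finset.sum_congr rfl fun i _ => ?_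
    rw [wedgeDeriv_ιMulti, ← Finset.add_sum_erase _ _ (Finset.mem_univ i),
      ← Finset.add_sum_erase (a := i) (s := Finset.univ)
        (fun j => if i = j then 0 else exteriorPower.ιMulti ℂ n
          (Function.update (Function.update v i (g (v i))) j (f (v j)))) (Finset.mem_univ i)]
    simp only [Function.update_self, Function.update_idem, if_true, zero_add]
    congr 1
    refine Finset.sum_congr rfl fun j hj => ?_
    have hji : j ≠ i := (Finset.mem_erase.mp hj).1
    simp [hji, hji.symm]
  suffices h : wedgeDeriv n (f * g - g * f) =
      wedgeDeriv n f ∘ₗ wedgeDeriv n g - wedgeDeriv n g ∘ₗ wedgeDeriv n f from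
    LinearMap.congr_fun h x
  apply exteriorPower.linearMap_ext
  ext1 v
  simp only [LinearMap.compAlternatingMap_apply, LinearMap.sub_apply, LinearMap.comp_apply]
  rw [key, key, wedgeDeriv_ιMulti]
  have hsymm : (∑ i, ∑ j, if i = j then 0 else exteriorPower.ιMulti ℂ n
        (Function.update (Function.update v i (g (v i))) j (f (v j)))) =
      ∑ i, ∑ j, if i = j then 0 else exteriorPower.ιMulti ℂ n
        (Function.update (Function.update v i (f (v i))) j (g (v j))) := by
    rw [Finset.sum_comm]
    refine Finset.sum_congr rfl fun i _ => Finset.sum_congr rfl fun j _ => ?_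
    by_cases h : i = j
    · simp [h]
    · rw [if_neg h, if_neg (Ne.symm h), Function.update_comm h]
  rw [hsymm, add_sub_add_right_eq_sub, ← Finset.sum_sub_distrib]
  refine Finset.sum_congr rfl fun i _ => ?_
  simp [AlternatingMap.map_update_sub]

variable {L : Type*} [LieRing L] [LieAlgebra ℂ L] [LieRingModule L M] [LieModule ℂ L M]

/-- The `n`-th exterior power of a Lie module, with
`x • (v₁ ∧ ⋯ ∧ vₙ) = ∑ᵢ v₁ ∧ ⋯ ∧ x vᵢ ∧ ⋯ ∧ vₙ`. -/
noncomputable instance exteriorPowerLieRingModule (n : ℕ) : LieRingModule L (⋀[ℂ]^n M) where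
  bracket x m := wedgeDeriv n (LieModule.toEnd ℂ L M x) m
  add_lie x y m := by
    rw [map_add, wedgeDeriv_add]; rfl
  lie_add x m m' := map_add _ m m'
  leibniz_lie x y m := by
    change wedgeDeriv n _ _ = wedgeDeriv n (LieModule.toEnd ℂ L M ⁅x, y⁆) m + wedgeDeriv n _ _
    have h : (LieModule.toEnd ℂ L M ⁅x, y⁆ : Module.End ℂ M) =
        LieModule.toEnd ℂ L M x * LieModule.toEnd ℂ L M y -
          LieModule.toEnd ℂ L M y * LieModule.toEnd ℂ L M x := by
      ext v
      simp
    rw [h, wedgeDeriv_lie, sub_add_cancel]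

instance exteriorPowerLieModule (n : ℕ) : LieModule ℂ L (⋀[ℂ]^n M) where
  smul_lie c x m := by
    change wedgeDeriv n (LieModule.toEnd ℂ L M (c • x)) m = _
    rw [map_smul, wedgeDeriv_smul]; rfl
  lie_smul c x m := map_smul (wedgeDeriv n (LieModule.toEnd ℂ L M x)) c m

end ExteriorPower

/-- A `ℤ`-graded module `M = ⨁ M[r]`, with finite-dimensional graded pieces, over a complex Lie
algebra `A` graded by the subspaces `𝒜 n`, `n ∈ ℕ`. -/
structure GradedRep {A : Type u} [LieRing A] [LieAlgebra ℂ A] (𝒜 : ℕ → Submodule ℂ A) where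
  /-- the underlying `A`-module -/
  carrier : Type u
  [addCommGroup : AddCommGroup carrier]
  [module : Module ℂ carrier]
  [lieRingModule : LieRingModule A carrier]
  [lieModule : LieModule ℂ A carrier]
  /-- the graded pieces -/
  piece : ℤ → Submodule ℂ carrier
  isInternal : DirectSum.IsInternal piece
  lie_mem : ∀ {n : ℕ} {r : ℤ} {x : A} {m : carrier},
    x ∈ 𝒜 n → m ∈ piece r → ⁅x, m⁆ ∈ piece (r + n)
  finiteDimensional : ∀ r, FiniteDimensional ℂ (piece r)

namespace GradedRep

/-- A family of submodules which admits projections is a grading. -/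
theorem isInternal_of_proj {M : Type*} [AddCommGroup M] [Module ℂ M] (C : ℤ → Submodule ℂ M)
    (p : ℤ → M →ₗ[ℂ] M) (hmem : ∀ r x, p r x ∈ C r) (hself : ∀ r x, x ∈ C r → p r x = x)
    (hne : ∀ r s x, x ∈ C s → r ≠ s → p r x = 0)
    (hfin : ∀ x, ∃ S : Finset ℤ, x = ∑ r ∈ S, p r x) : DirectSum.IsInternal C := by
  rw [DirectSum.isInternal_submodule_iff_iSupIndep_and_iSup_eq_top]
  constructor
  · intro r
    rw [Submodule.disjoint_def]
    intro x hx hx'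
    have : (⨆ j, ⨆ (_ : j ≠ r), C j) ≤ LinearMap.ker (p r) :=
      iSup₂_le fun s hs y hy => hne r s y hy hs.symm
    rw [← hself r x hx]
    exact this hx'
  · rw [eq_top_iff]
    intro x _
    obtain ⟨S, hS⟩ := hfin x
    rw [hS]
    exact Submodule.sum_mem _ fun r _ => Submodule.mem_iSup_of_mem r (hmem r x)

variable {A : Type u} [LieRing A] [LieAlgebra ℂ A] {𝒜 : ℕ → Submodule ℂ A}

instance : CoeSort (GradedRep 𝒜) (Type u) := ⟨carrier⟩

attribute [instance] addCommGroup module lieRingModule lieModule finiteDimensional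

/-- The decomposition of a graded module into its graded pieces. -/
noncomputable def decomp (X : GradedRep 𝒜) : (DirectSum ℤ fun r => X.piece r) ≃ₗ[ℂ] X :=
  LinearEquiv.ofBijective (DirectSum.coeLinearMap X.piece) X.isInternal

/-- The projection of a graded module to its `r`-th graded piece. -/
noncomputable def proj (X : GradedRep 𝒜) (r : ℤ) : X →ₗ[ℂ] X :=
  (X.piece r).subtype ∘ₗ DirectSum.component ℂ ℤ (fun i => X.piece i) r ∘ₗ X.decomp.symm.toLinearMap

section proj

variable (X : GradedRep 𝒜)

theorem proj_mem (r : ℤ) (x : X) : X.proj r x ∈ X.piece r :=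
  (DirectSum.component ℂ ℤ (fun i => X.piece i) r (X.decomp.symm x)).2

theorem decomp_symm_of_mem {r : ℤ} {x : X} (hx : x ∈ X.piece r) :
    X.decomp.symm x = DirectSum.lof ℂ ℤ (fun i => X.piece i) r ⟨x, hx⟩ := by
  rw [LinearEquiv.symm_apply_eq]
  exact (DirectSum.coeLinearMap_lof X.piece r ⟨x, hx⟩).symm

theorem proj_self {r : ℤ} {x : X} (hx : x ∈ X.piece r) : X.proj r x = x := by
  simp [proj, X.decomp_symm_of_mem hx, DirectSum.component.lof_self]

theorem proj_ne {r s : ℤ} {x : X} (hx : x ∈ X.piece s) (h : r ≠ s) : X.proj r x = 0 := by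
  simp [proj, X.decomp_symm_of_mem hx, DirectSum.component.of, h.symm]

theorem exists_sum_proj (x : X) : ∃ S : Finset ℤ, x = ∑ r ∈ S, X.proj r x := by
  classical
  refine ⟨DFinsupp.support (X.decomp.symm x), ?_⟩
  conv_lhs => rw [← X.decomp.apply_symm_apply x]
  exact DirectSum.coeLinearMap_eq_dfinsuppSum _ _

theorem exists_sum_proj' (x : X) :
    ∃ S : Finset ℤ, ∀ T : Finset ℤ, S ⊆ T → x = ∑ r ∈ T, X.proj r x := by
  obtain ⟨S, hS⟩ := X.exists_sum_proj x
  refine ⟨S, fun T hT => hS.trans (Finset.sum_subset hT fun r _ hr => ?_)⟩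
  rw [hS, map_sum]
  exact Finset.sum_eq_zero fun s hs =>
    X.proj_ne (X.proj_mem s x) fun h => hr (h ▸ hs)

theorem linearMap_ext_piece {M : Type*} [AddCommGroup M] [Module ℂ M] {f g : X →ₗ[ℂ] M}
    (h : ∀ r, ∀ x ∈ X.piece r, f x = g x) : f = g := by
  ext x
  obtain ⟨S, hS⟩ := X.exists_sum_proj x
  rw [hS, map_sum, map_sum]
  exact Finset.sum_congr rfl fun r _ => h r _ (X.proj_mem r x)

end proj

/-- Morphisms of graded modules: `A`-module maps of degree zero. -/
@[ext]
structure Hom (X Y : GradedRep 𝒜) where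
  /-- the underlying map of `A`-modules -/
  toLieModuleHom : X →ₗ⁅ℂ, A⁆ Y
  map_mem : ∀ {r : ℤ} {x : X}, x ∈ X.piece r → toLieModuleHom x ∈ Y.piece r

instance : Category (GradedRep 𝒜) where
  Hom := Hom
  id X := ⟨LieModuleHom.id, fun h => h⟩
  comp f g := ⟨g.toLieModuleHom.comp f.toLieModuleHom, fun h => g.map_mem (f.map_mem h)⟩

section hom

variable {X Y Z : GradedRep 𝒜}

/-- The `A`-module map underlying a morphism. -/
abbrev lin (f : X ⟶ Y) : X →ₗ⁅ℂ, A⁆ Y := Hom.toLieModuleHom f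

theorem lin_mem (f : X ⟶ Y) {r : ℤ} {x : X} (h : x ∈ X.piece r) : lin f x ∈ Y.piece r :=
  Hom.map_mem f h

theorem lin_injective : Function.Injective (lin (X := X) (Y := Y)) :=
  fun _ _ h => Hom.ext h

theorem hom_ext {f g : X ⟶ Y} (h : ∀ x, lin f x = lin g x) : f = g :=
  lin_injective (LieModuleHom.ext h)

@[simp] theorem lin_id (x : X) : lin (𝟙 X) x = x := rfl

@[simp] theorem lin_comp (f : X ⟶ Y) (g : Y ⟶ Z) (x : X) : lin (f ≫ g) x = lin g (lin f x) := rfl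

/-- Constructor for morphisms. -/
def homMk (f : X →ₗ⁅ℂ, A⁆ Y) (hf : ∀ {r : ℤ} {x : X}, x ∈ X.piece r → f x ∈ Y.piece r) :
    X ⟶ Y := ⟨f, hf⟩

@[simp] theorem lin_homMk (f : X →ₗ⁅ℂ, A⁆ Y)
    (hf : ∀ {r : ℤ} {x : X}, x ∈ X.piece r → f x ∈ Y.piece r) : lin (homMk f hf) = f := rfl

theorem lin_proj (f : X ⟶ Y) (r : ℤ) (x : X) : lin f (X.proj r x) = Y.proj r (lin f x) := by
  suffices h : (lin f : X →ₗ[ℂ] Y) ∘ₗ X.proj r = Y.proj r ∘ₗ (lin f : X →ₗ[ℂ] Y) from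
    LinearMap.congr_fun h x
  apply X.linearMap_ext_piece
  intro s x hx
  by_cases h : r = s
  · subst h
    simp [X.proj_self hx, Y.proj_self (lin_mem f hx)]
  · simp [X.proj_ne hx h, Y.proj_ne (lin_mem f hx) h]

theorem mem_piece_of_injective (f : X ⟶ Y) (hf : Function.Injective (lin f)) {r : ℤ} {x : X}
    (h : lin f x ∈ Y.piece r) : x ∈ X.piece r := by
  have : X.proj r x = x := hf (by rw [lin_proj, Y.proj_self h])
  rw [← this]
  exact X.proj_mem r x

theorem exists_mem_of_surjective (f : X ⟶ Y) (hf : Function.Surjective (lin f)) {r : ℤ} {y : Y}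
    (h : y ∈ Y.piece r) : ∃ x ∈ X.piece r, lin f x = y := by
  obtain ⟨x, rfl⟩ := hf y
  exact ⟨X.proj r x, X.proj_mem r x, by rw [lin_proj, Y.proj_self h]⟩

instance : Zero (X ⟶ Y) := ⟨homMk 0 fun _ => Submodule.zero_mem _⟩
instance : Add (X ⟶ Y) := ⟨fun f g => homMk (lin f + lin g) fun h =>
  Submodule.add_mem _ (lin_mem f h) (lin_mem g h)⟩
instance : Neg (X ⟶ Y) := ⟨fun f => homMk (-lin f) fun h => Submodule.neg_mem _ (lin_mem f h)⟩
instance : Sub (X ⟶ Y) := ⟨fun f g => homMk (lin f - lin g) fun h =>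
  Submodule.sub_mem _ (lin_mem f h) (lin_mem g h)⟩
instance : SMul ℂ (X ⟶ Y) := ⟨fun c f => homMk (c • lin f) fun h =>
  Submodule.smul_mem _ c (lin_mem f h)⟩
instance : SMul ℕ (X ⟶ Y) := ⟨fun n f => homMk (n • lin f) fun {r x} h => by
  rw [LieModuleHom.nsmul_apply]; exact nsmul_mem (lin_mem f h) n⟩
instance : SMul ℤ (X ⟶ Y) := ⟨fun n f => homMk (n • lin f) fun {r x} h => by
  rw [LieModuleHom.zsmul_apply]; exact zsmul_mem (lin_mem f h) n⟩

instance : AddCommGroup (X ⟶ Y) :=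
  lin_injective.addCommGroup lin rfl (fun _ _ => rfl) (fun _ => rfl) (fun _ _ => rfl)
    (fun _ _ => rfl) (fun _ _ => rfl)

/-- The underlying `A`-module map, as an additive map. -/
def linAddHom : (X ⟶ Y) →+ (X →ₗ⁅ℂ, A⁆ Y) where
  toFun := lin
  map_zero' := rfl
  map_add' _ _ := rfl

instance : Module ℂ (X ⟶ Y) :=
  lin_injective.module ℂ (linAddHom (X := X) (Y := Y)) fun _ _ => rfl

@[simp] theorem lin_zero (x : X) : lin (0 : X ⟶ Y) x = 0 := rfl
@[simp] theorem lin_add (f g : X ⟶ Y) (x : X) : lin (f + g) x = lin f x + lin g x := rfl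
@[simp] theorem lin_smul (c : ℂ) (f : X ⟶ Y) (x : X) : lin (c • f) x = c • lin f x := rfl

end hom

instance : Preadditive (GradedRep 𝒜) where
  add_comp _ _ _ f f' g := hom_ext fun x => by simp
  comp_add _ _ _ f g g' := hom_ext fun x => by simp

instance : Linear ℂ (GradedRep 𝒜) where
  smul_comp _ _ _ c f g := hom_ext fun x => by simp
  comp_smul _ _ _ f c g := hom_ext fun x => by simp

/-- A homogeneous `A`-submodule, as a graded module. -/
def sub (X : GradedRep 𝒜) (N : LieSubmodule ℂ A X) (hN : ∀ r, ∀ x ∈ N, X.proj r x ∈ N) :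
    GradedRep 𝒜 where
  carrier := N
  piece r := (X.piece r).comap (N : Submodule ℂ X).subtype
  isInternal := by
    refine isInternal_of_proj _ (fun r => (X.proj r).restrict (p := (N : Submodule ℂ X))
      (q := (N : Submodule ℂ X)) (hN r)) ?_ ?_ ?_ ?_
    · intro r x
      exact X.proj_mem r _
    · intro r x hx
      exact Subtype.ext (X.proj_self hx)
    · intro r s x hx h
      exact Subtype.ext (X.proj_ne hx h)
    · intro x
      obtain ⟨S, hS⟩ := X.exists_sum_proj (x : X)
      refine ⟨S, Subtype.ext ?_⟩
      refine hS.trans ?_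
      rw [AddSubmonoidClass.coe_finsetSum]
      rfl
  lie_mem hx hm := X.lie_mem hx hm
  finiteDimensional r := by
    refine Module.Finite.of_injective
      (((N : Submodule ℂ X).subtype).restrict (p := (X.piece r).comap (N : Submodule ℂ X).subtype)
        (q := X.piece r) fun x hx => hx) ?_
    intro x y h
    exact Subtype.ext (Subtype.ext (congrArg (fun z : X.piece r => (z : X)) h))

/-- The quotient by a homogeneous `A`-submodule, as a graded module. -/
def quot (X : GradedRep 𝒜) (N : LieSubmodule ℂ A X) (hN : ∀ r, ∀ x ∈ N, X.proj r x ∈ N) :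
    GradedRep 𝒜 where
  carrier := X ⧸ N
  piece r := (X.piece r).map (N : Submodule ℂ X).mkQ
  isInternal := by
    refine isInternal_of_proj _ (fun r => (N : Submodule ℂ X).mapQ (N : Submodule ℂ X) (X.proj r)
      (hN r)) ?_ ?_ ?_ ?_
    · intro r x
      obtain ⟨x, rfl⟩ := (N : Submodule ℂ X).mkQ_surjective x
      exact ⟨_, X.proj_mem r x, rfl⟩
    · rintro r _ ⟨x, hx, rfl⟩
      exact congrArg (N : Submodule ℂ X).mkQ (X.proj_self hx)
    · rintro r s _ ⟨x, hx, rfl⟩ h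
      exact (congrArg (N : Submodule ℂ X).mkQ (X.proj_ne hx h)).trans (map_zero _)
    · intro x
      obtain ⟨x, rfl⟩ := (N : Submodule ℂ X).mkQ_surjective x
      obtain ⟨S, hS⟩ := X.exists_sum_proj x
      exact ⟨S, (congrArg (N : Submodule ℂ X).mkQ hS).trans (map_sum _ _ _)⟩
  lie_mem := by
    rintro n r x _ hx ⟨m, hm, rfl⟩
    exact ⟨_, X.lie_mem hx hm, rfl⟩
  finiteDimensional r := inferInstance

instance prodLieRingModule (X Y : GradedRep 𝒜) : LieRingModule A (X × Y) where
  bracket a m := (⁅a, m.1⁆, ⁅a, m.2⁆)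
  add_lie a b m := Prod.ext (add_lie a b m.1) (add_lie a b m.2)
  lie_add a m m' := Prod.ext (lie_add a m.1 m'.1) (lie_add a m.2 m'.2)
  leibniz_lie a b m := Prod.ext (leibniz_lie a b m.1) (leibniz_lie a b m.2)

instance prodLieModule (X Y : GradedRep 𝒜) : LieModule ℂ A (X × Y) where
  smul_lie c a m := Prod.ext (smul_lie c a m.1) (smul_lie c a m.2)
  lie_smul c a m := Prod.ext (lie_smul c a m.1) (lie_smul c a m.2)

/-- The direct sum of two graded modules. -/
def prod (X Y : GradedRep 𝒜) : GradedRep 𝒜 where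
  carrier := X × Y
  piece r := (X.piece r).prod (Y.piece r)
  isInternal := by
    refine isInternal_of_proj _ (fun r => (X.proj r).prodMap (Y.proj r)) ?_ ?_ ?_ ?_
    · intro r x
      exact ⟨X.proj_mem r _, Y.proj_mem r _⟩
    · intro r x hx
      exact Prod.ext (X.proj_self hx.1) (Y.proj_self hx.2)
    · intro r s x hx h
      exact Prod.ext (X.proj_ne hx.1 h) (Y.proj_ne hx.2 h)
    · classical
      intro x
      obtain ⟨S, hS⟩ := X.exists_sum_proj' x.1
      obtain ⟨T, hT⟩ := Y.exists_sum_proj' x.2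
      refine ⟨S ∪ T, Prod.ext ?_ ?_⟩
      · rw [Prod.fst_sum]
        exact hS _ Finset.subset_union_left
      · rw [Prod.snd_sum]
        exact hT _ Finset.subset_union_right
  lie_mem hx hm := ⟨X.lie_mem hx hm.1, Y.lie_mem hx hm.2⟩
  finiteDimensional r :=
    Submodule.finiteDimensional_of_le (S₂ := ((X.piece r).map (LinearMap.inl ℂ X Y)) ⊔
      ((Y.piece r).map (LinearMap.inr ℂ X Y))) fun x hx =>
        Submodule.mem_sup.mpr ⟨(x.1, 0), ⟨x.1, hx.1, rfl⟩, (0, x.2), ⟨x.2, hx.2, rfl⟩, by simp⟩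

instance punitLieRingModule : LieRingModule A PUnit.{u + 1} where
  bracket _ _ := 0
  add_lie _ _ _ := rfl
  lie_add _ _ _ := rfl
  leibniz_lie _ _ _ := rfl

instance punitLieModule : LieModule ℂ A PUnit.{u + 1} where
  smul_lie _ _ _ := rfl
  lie_smul _ _ _ := rfl

/-- The zero graded module. -/
def zeroRep : GradedRep 𝒜 where
  carrier := PUnit
  piece _ := ⊤
  isInternal := isInternal_of_proj _ (fun _ => 0) (fun _ _ => trivial) (fun _ _ _ => rfl)
    (fun _ _ _ _ _ => rfl) (fun _ => ⟨∅, rfl⟩)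
  lie_mem _ _ := trivial
  finiteDimensional _ := inferInstance

open Limits

instance : HasZeroObject (GradedRep 𝒜) where
  zero := ⟨zeroRep, by
    rw [IsZero.iff_id_eq_zero]
    exact hom_ext fun _ => rfl⟩

section factor

variable {X Y Z : GradedRep 𝒜}

/-- A morphism with values in the image of an injective morphism factors through it. -/
theorem exists_lift (i : X ⟶ Y) (hi : Function.Injective (lin i)) (g : Z ⟶ Y)
    (h : ∀ z, ∃ x, lin i x = lin g z) : ∃ k : Z ⟶ X, k ≫ i = g := by
  choose k hk using h
  refine ⟨homMk ⟨⟨⟨k, fun a b => hi ?_⟩, fun c a => hi ?_⟩, fun {a m} => hi ?_⟩ ?_, ?_⟩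
  · simp [hk]
  · simp [hk]
  · change lin i (k ⁅a, m⁆) = lin i ⁅a, k m⁆
    simp [hk]
  · intro r z hz
    refine mem_piece_of_injective i hi ?_
    change lin i (k z) ∈ _
    rw [hk]
    exact lin_mem g hz
  · exact hom_ext fun z => hk z

/-- A morphism vanishing on the kernel of a surjective morphism factors through it. -/
theorem exists_desc (p : X ⟶ Y) (hp : Function.Surjective (lin p)) (g : X ⟶ Z)
    (h : ∀ x, lin p x = 0 → lin g x = 0) : ∃ k : Y ⟶ Z, p ≫ k = g := by
  choose q hq using hp
  have key : ∀ x x', lin p x = lin p x' → lin g x = lin g x' := fun x x' e => by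
    rw [← sub_eq_zero, ← map_sub]
    exact h _ (by rw [map_sub, e, sub_self])
  refine ⟨homMk ⟨⟨⟨fun y => lin g (q y), fun a b => ?_⟩, fun c a => ?_⟩, fun {a m} => ?_⟩ ?_, ?_⟩
  · rw [← map_add]
    exact key _ _ (by simp [hq])
  · rw [← map_smul]
    exact key _ _ (by simp [hq])
  · change lin g (q ⁅a, m⁆) = ⁅a, lin g (q m)⁆
    rw [← LieModuleHom.map_lie]
    exact key _ _ (by simp [hq])
  · intro r y hy
    obtain ⟨x, hx, rfl⟩ := exists_mem_of_surjective p (fun y => ⟨q y, hq y⟩) hy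
    change lin g (q (lin p x)) ∈ _
    rw [key _ x (hq _)]
    exact lin_mem g hx
  · exact hom_ext fun x => key _ _ (hq _)

/-- The kernel of a morphism. -/
def ker (f : X ⟶ Y) : GradedRep 𝒜 :=
  X.sub (lin f).ker fun r x hx => by
    rw [LieModuleHom.mem_ker] at hx ⊢
    rw [lin_proj, hx, map_zero]

/-- The inclusion of the kernel of a morphism. -/
def kerι (f : X ⟶ Y) : ker f ⟶ X := homMk (lin f).ker.incl fun h => h

/-- The cokernel of a morphism. -/
def coker (f : X ⟶ Y) : GradedRep 𝒜 :=
  Y.quot (lin f).range fun r y hy => by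
    rw [LieModuleHom.mem_range] at hy ⊢
    obtain ⟨x, rfl⟩ := hy
    exact ⟨X.proj r x, lin_proj f r x⟩

/-- The projection to the cokernel of a morphism. -/
def cokerπ (f : X ⟶ Y) : Y ⟶ coker f :=
  homMk (LieSubmodule.Quotient.mk' (lin f).range) fun {_ x} h => ⟨x, h, rfl⟩

theorem kerι_injective (f : X ⟶ Y) : Function.Injective (lin (kerι f)) :=
  Subtype.val_injective

theorem lin_kerι (f : X ⟶ Y) (x : ker f) : lin f (lin (kerι f) x) = 0 :=
  LieModuleHom.mem_ker.mp x.2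

theorem cokerπ_surjective (f : X ⟶ Y) : Function.Surjective (lin (cokerπ f)) :=
  LieSubmodule.Quotient.surjective_mk' _

theorem cokerπ_eq_zero (f : X ⟶ Y) (y : Y) : lin (cokerπ f) y = 0 ↔ ∃ x, lin f x = y :=
  (LieSubmodule.Quotient.mk_eq_zero' (N := (lin f).range)).trans (LieModuleHom.mem_range _ _)

/-- An injective morphism is a kernel of every morphism with which it forms an exact sequence. -/
noncomputable def isLimitOfExact (i : X ⟶ Y) (p : Y ⟶ Z) (w : i ≫ p = 0)
    (hi : Function.Injective (lin i)) (h : ∀ y, lin p y = 0 → ∃ x, lin i x = y) :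
    IsLimit (KernelFork.ofι i w) :=
  have H : ∀ {W : GradedRep 𝒜} (g : W ⟶ Y), g ≫ p = 0 → ∃ k : W ⟶ X, k ≫ i = g :=
    fun g hg => exists_lift i hi g fun z => h _ (by rw [← lin_comp, hg, lin_zero])
  KernelFork.IsLimit.ofι i w (fun g hg => (H g hg).choose) (fun g hg => (H g hg).choose_spec)
    fun g hg m hm => hom_ext fun z => hi (by
      rw [← lin_comp, ← lin_comp, hm, (H g hg).choose_spec])

/-- A surjective morphism is a cokernel of every morphism with which it forms an exact
sequence. -/
noncomputable def isColimitOfExact (i : X ⟶ Y) (p : Y ⟶ Z) (w : i ≫ p = 0)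
    (hp : Function.Surjective (lin p)) (h : ∀ y, lin p y = 0 → ∃ x, lin i x = y) :
    IsColimit (CokernelCofork.ofπ p w) :=
  have H : ∀ {W : GradedRep 𝒜} (g : Y ⟶ W), i ≫ g = 0 → ∃ k : Z ⟶ W, p ≫ k = g :=
    fun g hg => exists_desc p hp g fun y hy => by
      obtain ⟨x, rfl⟩ := h y hy
      rw [← lin_comp, hg, lin_zero]
  CokernelCofork.IsColimit.ofπ p w (fun g hg => (H g hg).choose)
    (fun g hg => (H g hg).choose_spec)
    fun g hg m hm => hom_ext fun z => by
      obtain ⟨y, rfl⟩ := hp z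
      rw [← lin_comp, ← lin_comp, hm, (H g hg).choose_spec]

theorem kerι_comp (f : X ⟶ Y) : kerι f ≫ f = 0 := hom_ext (lin_kerι f)

theorem comp_cokerπ (f : X ⟶ Y) : f ≫ cokerπ f = 0 :=
  hom_ext fun x => (cokerπ_eq_zero f _).mpr ⟨x, rfl⟩

theorem injective_of_mono (f : X ⟶ Y) [Mono f] : Function.Injective (lin f) := by
  have h : kerι f = 0 := by rw [← cancel_mono f, kerι_comp, zero_comp]
  rw [injective_iff_map_eq_zero]
  intro x hx
  let x' : ker f := ⟨x, LieModuleHom.mem_ker.mpr hx⟩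
  have : lin (kerι f) x' = 0 := by rw [h, lin_zero]
  exact this

theorem surjective_of_epi (f : X ⟶ Y) [Epi f] : Function.Surjective (lin f) := by
  have h : cokerπ f = 0 := by rw [← cancel_epi f, comp_cokerπ, comp_zero]
  exact fun y => (cokerπ_eq_zero f y).mp (by rw [h, lin_zero])

end factor

instance : HasKernels (GradedRep 𝒜) where
  has_limit f := ⟨⟨⟨_, isLimitOfExact (kerι f) f (kerι_comp f) (kerι_injective f)
    fun y hy => ⟨⟨y, LieModuleHom.mem_ker.mpr hy⟩, rfl⟩⟩⟩⟩

instance : HasCokernels (GradedRep 𝒜) where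
  has_colimit f := ⟨⟨⟨_, isColimitOfExact f (cokerπ f) (comp_cokerπ f) (cokerπ_surjective f)
    fun y hy => (cokerπ_eq_zero f y).mp hy⟩⟩⟩

/-- The direct sum as a biproduct. -/
def prodBicone (X Y : GradedRep 𝒜) : BinaryBicone X Y where
  pt := X.prod Y
  fst := homMk ⟨LinearMap.fst ℂ X Y, rfl⟩ fun h => h.1
  snd := homMk ⟨LinearMap.snd ℂ X Y, rfl⟩ fun h => h.2
  inl := homMk ⟨LinearMap.inl ℂ X Y, fun {a _} => Prod.ext rfl (lie_zero a).symm⟩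
    fun h => ⟨h, Submodule.zero_mem _⟩
  inr := homMk ⟨LinearMap.inr ℂ X Y, fun {a _} => Prod.ext (lie_zero a).symm rfl⟩
    fun h => ⟨Submodule.zero_mem _, h⟩
  inl_fst := rfl
  inl_snd := rfl
  inr_fst := rfl
  inr_snd := rfl

instance : HasBinaryBiproducts (GradedRep 𝒜) where
  has_binary_biproduct X Y := hasBinaryBiproduct_of_total (prodBicone X Y)
    (hom_ext fun x => Prod.ext (add_zero x.1) (zero_add x.2))

noncomputable instance : Abelian (GradedRep 𝒜) where
  has_finite_products := hasFiniteProducts_of_has_binary_and_terminal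
  normalMonoOfMono f _ := ⟨{
    Z := coker f
    g := cokerπ f
    w := comp_cokerπ f
    isLimit := isLimitOfExact f (cokerπ f) (comp_cokerπ f) (injective_of_mono f)
      fun y hy => (cokerπ_eq_zero f y).mp hy }⟩
  normalEpiOfEpi f _ := ⟨{
    W := ker f
    g := kerι f
    w := kerι_comp f
    isColimit := isColimitOfExact (kerι f) f (kerι_comp f) (surjective_of_epi f)
      fun y hy => ⟨⟨y, LieModuleHom.mem_ker.mpr hy⟩, rfl⟩ }⟩

/-- `Ext` groups are available in every abelian category, in a large enough universe. -/
instance : HasExt.{u + 1} (GradedRep 𝒜) := HasExt.standard _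

/-- The grading shift `τ_d`, with `(τ_d M)[k] = M[k - d]`. -/
def shift (d : ℤ) (X : GradedRep 𝒜) : GradedRep 𝒜 where
  carrier := X
  piece k := X.piece (k - d)
  isInternal := by
    refine isInternal_of_proj _ (fun k => X.proj (k - d)) (fun k => X.proj_mem _)
      (fun k x hx => X.proj_self hx) (fun k l x hx h => X.proj_ne hx (by omega)) fun x => ?_
    obtain ⟨S, hS⟩ := X.exists_sum_proj x
    refine ⟨S.map (Equiv.addRight d).toEmbedding, hS.trans ?_⟩
    simp
  lie_mem {n r x m} hx hm := by
    rw [show r + n - d = r - d + n by ring]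
    exact X.lie_mem hx hm
  finiteDimensional k := X.finiteDimensional (k - d)

end GradedRep

section SemidirectProduct

variable (L V : Type u) [LieRing L] [LieAlgebra ℂ L]
  [AddCommGroup V] [Module ℂ V] [LieRingModule L V] [LieModule ℂ L V]

/-- A vector space regarded as an abelian Lie algebra. -/
def AbelianLie (V : Type u) : Type u := V

instance : AddCommGroup (AbelianLie V) := inferInstanceAs (AddCommGroup V)

instance : Module ℂ (AbelianLie V) := inferInstanceAs (Module ℂ V)

instance : LieRingModule L (AbelianLie V) := inferInstanceAs (LieRingModule L V)

instance : LieModule ℂ L (AbelianLie V) := inferInstanceAs (LieModule ℂ L V)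

instance : LieRing (AbelianLie V) where
  bracket _ _ := 0
  add_lie _ _ _ := (add_zero 0).symm
  lie_add _ _ _ := (add_zero 0).symm
  lie_self _ := rfl
  leibniz_lie _ _ _ := (add_zero 0).symm

instance : LieAlgebra ℂ (AbelianLie V) where
  lie_smul c _ _ := (smul_zero c).symm

/-- The action of `L` on the `L`-module `V`, by derivations of the abelian Lie algebra `V`. -/
def actionDerivation : L →ₗ⁅ℂ⁆ LieDerivation ℂ (AbelianLie V) (AbelianLie V) where
  toFun x :=
    { toLinearMap := (LieModule.toEnd ℂ L (AbelianLie V) x : AbelianLie V →ₗ[ℂ] AbelianLie V)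
      leibniz' := fun _ _ => (lie_zero x).trans (sub_zero 0).symm }
  map_add' x y := LieDerivation.ext fun v => add_lie x y v
  map_smul' c x := LieDerivation.ext fun v => smul_lie c x v
  map_lie' {x y} := LieDerivation.ext fun v => lie_lie x y v

/-- The semidirect product `L ⋉ V` of a Lie algebra `L` and an `L`-module `V`, in which `V` is
an abelian ideal. -/
abbrev SemidirectLie : Type u :=
  LieAlgebra.SemiDirectSum (AbelianLie V) L (actionDerivation L V)

/-- The grading of `L ⋉ V` with `L` in degree zero and `V` in degree one. -/
def semidirectGrading : ℕ → Submodule ℂ (SemidirectLie L V)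
  | 0 => LinearMap.range (LieAlgebra.SemiDirectSum.inr (actionDerivation L V)).toLinearMap
  | 1 => LinearMap.range (LieAlgebra.SemiDirectSum.inl (actionDerivation L V)).toLinearMap
  | _ + 2 => ⊥

/-- The abelian category of `ℤ`-graded `L ⋉ V`-modules with finite-dimensional graded pieces,
with the degree zero module maps as morphisms. -/
abbrev GHat : Type (u + 1) := GradedRep (semidirectGrading L V)

/-- The finite-dimensional `L`-module `S`, placed in degree zero, with `V` acting by zero. -/
noncomputable def ev (S : Type u) [AddCommGroup S] [Module ℂ S] [LieRingModule L S]
    [LieModule ℂ L S] [FiniteDimensional ℂ S] : GHat L V where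
  carrier := S
  lieRingModule :=
    LieRingModule.compLieHom S (LieAlgebra.SemiDirectSum.projr (actionDerivation L V))
  lieModule := LieModule.compLieHom S (LieAlgebra.SemiDirectSum.projr (actionDerivation L V))
  piece k := if k = 0 then ⊤ else ⊥
  isInternal := by
    refine GradedRep.isInternal_of_proj _ (fun k => if k = 0 then LinearMap.id else 0) ?_ ?_ ?_ ?_
    · intro k x
      by_cases h : k = 0 <;> simp [h]
    · intro k x hx
      by_cases h : k = 0 <;> simp_all
    · intro k l x hx h
      by_cases hk : k = 0
      · rw [if_neg (by omega)] at hx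
        simpa [hk] using hx
      · simp [hk]
    · exact fun x => ⟨{0}, by simp⟩
  lie_mem := by
    rintro n k ⟨v, x⟩ m hx hm
    change ⁅x, m⁆ ∈ _
    by_cases hk : k = 0
    · match n, hx with
      | 0, _ => simp [hk]
      | 1, ⟨w, hw⟩ =>
        have : x = 0 := (congrArg LieAlgebra.SemiDirectSum.right hw).symm
        simp [this]
      | n + 2, hx =>
        have : x = 0 := congrArg LieAlgebra.SemiDirectSum.right ((Submodule.mem_bot ℂ).mp hx)
        simp [this]
    · have : m = 0 := by simpa [hk] using hm
      simp [this]
  finiteDimensional k := inferInstance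

/-- The `L`-module `S` placed in degree `r`, with `V` acting by zero. -/
noncomputable def evShift (S : Type u) [AddCommGroup S] [Module ℂ S] [LieRingModule L S]
    [LieModule ℂ L S] [FiniteDimensional ℂ S] (r : ℤ) : GHat L V :=
  GradedRep.shift r (ev L V S)

end SemidirectProduct

section HighestWeight

variable {L : Type u} [LieRing L] [LieAlgebra ℂ L] [FiniteDimensional ℂ L]
  [LieAlgebra.IsSemisimple ℂ L] {H : LieSubalgebra ℂ L} [H.IsCartanSubalgebra]

/-- The set `P⁺` of dominant integral weights: the weights `μ` for which `μ(hᵢ)` is a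
non-negative integer for every simple coroot `hᵢ`. -/
def dominantWeights (b : (LieAlgebra.IsKilling.rootSystem H).Base) : Set (Module.Dual ℂ H) :=
  {μ | ∀ i ∈ b.support, ∃ n : ℕ, μ ((LieAlgebra.IsKilling.rootSystem H).coroot i) = n}

/-- `S` is the simple module `V(μ)` of highest weight `μ`: it is simple, and it contains a nonzero
vector of weight `μ` which is annihilated by all positive root spaces. -/
structure IsSimpleOfHighestWeight (b : (LieAlgebra.IsKilling.rootSystem H).Base)
    (μ : Module.Dual ℂ H) (S : Type u) [AddCommGroup S] [Module ℂ S] [LieRingModule L S]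
    [LieModule ℂ L S] : Prop where
  isIrreducible : LieModule.IsIrreducible ℂ L S
  exists_highest_weight_vector : ∃ v : S, v ≠ 0 ∧ (∀ h : H, ⁅(h : L), v⁆ = μ h • v) ∧
    ∀ α : H.root, b.IsPos α → ∀ x ∈ LieAlgebra.rootSpace H (α : LieModule.Weight ℂ H L), ⁅x, v⁆ = 0

end HighestWeight

/-! The `Ext` groups are read off from a Koszul resolution whose complex of morphisms to `V(ν, s)`
has zero differential.

For a finite-dimensional `g`-module `W`, the module `Sym V ⊗ W` induced from `g` to `g ⋉ V`,
generated by `W` in degree `k`, satisfies Frobenius reciprocity (`inducedHomEquiv`): its morphisms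
to `M` are the `g`-maps `W → M[k]`. A `g`-map to `M[k]` lifts along a surjection of
finite-dimensional `g`-modules by complete reducibility, so these modules are projective
(`projective_inducedRep`). Complete reducibility is used as the lifting statement
`exists_lieModuleHom_comp_eq`. It comes from the decomposition of a finite-dimensional `M` as the
sum of its invariants and `⁅g, M⁆`, proved by induction on dimension with a family of Casimir
operators.

The terms `Sym V ⊗ ⋀ⁿ V ⊗ V(μ)`, generated in degree `r + n`, form a resolution of `V(μ, r)`. The
differential `∑ Xᵢ ⊗ ι(bᵢ*)` and the de Rham operator `∑ ∂ᵢ ⊗ (bᵢ ∧ ·)` satisfy a homotopy identity: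
their anticommutator is multiplication by polynomial degree plus exterior degree
(`koszul_homotopy_identity`). This number is invertible in characteristic zero except in bidegree
`(0, 0)`, which the augmentation identifies with `V(μ)`.

The differential takes generators into the span of `V` times the next term, and `V` acts by zero on
`V(ν, s)`; hence every morphism from the resolution to `V(ν, s)` is a cocycle
(`koszulMap_comp_eq_zero`). Dimension shifting along the syzygies then identifies `Ext^j` with the
morphisms from the `j`-th projective term, that is, with the `g`-maps from `⋀ʲ V ⊗ V(μ)` to the
piece of `V(ν, s)` of degree `r + j`. This piece is `V(ν)` if `r + j = s` and zero otherwise. -/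

namespace CategoryTheory.Abelian

open Limits

/-! ### Syzygies of a resolution -/

section Syzygy

universe v u'

variable {C : Type u'} [Category.{v} C] [Abelian C] (Q : ℕ → C) (d : ∀ n, Q (n + 1) ⟶ Q n)

/-- The syzygies of a resolution `⋯ ⟶ Q 2 ⟶ Q 1 ⟶ Q 0`, starting with `Q 0`. -/
noncomputable def syzygy : ℕ → C
  | 0 => Q 0
  | n + 1 => kernel (d n)

/-- The inclusion of a syzygy in a term of the resolution. -/
noncomputable def syzygyι (n : ℕ) : syzygy Q d (n + 1) ⟶ Q (n + 1) := kernel.ι (d n)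

instance (n : ℕ) : Mono (syzygyι Q d n) := inferInstanceAs (Mono (kernel.ι (d n)))

variable (hd : ∀ n, d (n + 1) ≫ d n = 0)

/-- The projection of a term of a resolution to the syzygy. -/
noncomputable def toSyzygy : ∀ n, Q (n + 1) ⟶ syzygy Q d n
  | 0 => d 0
  | n + 1 => kernel.lift (d n) (d (n + 1)) (hd n)

theorem toSyzygy_comp_syzygyι (n : ℕ) :
    toSyzygy Q d hd (n + 1) ≫ syzygyι Q d n = d (n + 1) :=
  kernel.lift_ι _ _ _

variable {Q d}

/-- Beyond `n = 0`, where the two maps coincide, `d n` is `toSyzygy` followed by a monomorphism.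
Hence the kernel of `d n` is also the kernel of `toSyzygy`. -/
theorem comp_toSyzygy_eq_zero {A : C} {n : ℕ} (f : A ⟶ Q (n + 1)) :
    f ≫ toSyzygy Q d hd n = 0 ↔ f ≫ d n = 0 := by
  cases n with
  | zero => rfl
  | succ n =>
    rw [← toSyzygy_comp_syzygyι Q d hd n]
    exact ⟨fun h => by rw [← Category.assoc, h, zero_comp], fun h => by
      rwa [← cancel_mono (syzygyι Q d n), zero_comp, Category.assoc]⟩

/-- The short complex relating two consecutive syzygies. -/
noncomputable abbrev syzygyComplex (n : ℕ) : ShortComplex C :=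
  ShortComplex.mk (syzygyι Q d n) (toSyzygy Q d hd n)
    ((comp_toSyzygy_eq_zero hd _).mpr (kernel.condition (d n)))

variable (hex : ∀ n, (ShortComplex.mk _ _ (hd n)).Exact) [Epi (d 0)]

include hex in
theorem epi_toSyzygy (n : ℕ) : Epi (toSyzygy Q d hd n) := by
  cases n with
  | zero => assumption
  | succ n => exact (ShortComplex.exact_iff_epi_kernel_lift _).mp (hex n)

-- Exactness of the resolution enters only through the surjectivity of `toSyzygy`; the left half is
-- the definition of the next syzygy as a kernel.
include hex in
theorem syzygyComplex_shortExact (n : ℕ) : (syzygyComplex hd n).ShortExact := by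
  have : Epi (syzygyComplex hd n).g := epi_toSyzygy hd hex n
  refine ShortComplex.ShortExact.mk (ShortComplex.exact_of_f_is_kernel _ ?_)
  refine KernelFork.IsLimit.ofι' _ _ fun g hg => ?_
  exact ⟨kernel.lift (d n) g ((comp_toSyzygy_eq_zero hd g).mp hg), kernel.lift_ι _ _ _⟩

end Syzygy

/-! ### Dimension shifting for `Ext` -/

section DimensionShifting

universe w v u' t

variable {k : Type t} [CommRing k] {C : Type u'} [Category.{v} C] [Abelian C] [Linear k C]
  [HasExt.{w} C]

/-- Dimension shifting along a short exact sequence whose middle term is projective. -/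
theorem Ext.nonempty_linearEquiv_succ {S : ShortComplex C} (hS : S.ShortExact)
    [Projective S.X₂] {Y : C} (hY : ∀ f : S.X₂ ⟶ Y, S.f ≫ f = 0) (n : ℕ) :
    Nonempty (Ext S.X₃ Y (n + 1) ≃ₗ[k] Ext S.X₁ Y n) := by
  refine ⟨(LinearEquiv.ofBijective
    (Ext.precompOfLinear hS.extClass k Y (add_comm 1 n)) ⟨?_, ?_⟩).symm⟩
  · rw [injective_iff_map_eq_zero]
    intro x hx
    obtain ⟨y, rfl⟩ := Ext.contravariant_sequence_exact₁ hS Y x (add_comm 1 n) hx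
    -- The class `y` lies in `Ext^n(X₂, Y)`. For `n = 0` it is a morphism, which restricts to zero
    -- on `X₁` by `hY`; for `n > 0` it is zero because `X₂` is projective.
    cases n with
    | zero =>
      obtain ⟨f, rfl⟩ := (Ext.mk₀_bijective _ _).2 y
      rw [Ext.mk₀_comp_mk₀, hY, Ext.mk₀_zero]
    | succ n => rw [Ext.eq_zero_of_projective y, Ext.comp_zero]
  · intro x
    exact Ext.contravariant_sequence_exact₃ hS Y x (Ext.eq_zero_of_projective _) (add_comm 1 n)

/-- If every morphism from the terms of a projective resolution of `Q 0` to `Y` is a cocycle, then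
the `Ext` groups are these groups of morphisms. -/
theorem Ext.nonempty_linearEquiv_of_resolution {Q : ℕ → C} {d : ∀ n, Q (n + 1) ⟶ Q n}
    (hd : ∀ n, d (n + 1) ≫ d n = 0) (hex : ∀ n, (ShortComplex.mk _ _ (hd n)).Exact) [Epi (d 0)]
    [∀ n, Projective (Q (n + 1))] {Y : C}
    (hY : ∀ n (f : Q (n + 1) ⟶ Y), d (n + 1) ≫ f = 0) (j : ℕ) :
    Nonempty (Ext (Q 0) Y j ≃ₗ[k] (Q (j + 1) ⟶ Y)) := by
  -- The next term of the resolution maps onto the syzygy, so a cocycle restricts to zero on it.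
  have hY' : ∀ n (f : Q (n + 1) ⟶ Y), syzygyι Q d n ≫ f = 0 := fun n f => by
    have := epi_toSyzygy hd hex (n + 1)
    rw [← cancel_epi (toSyzygy Q d hd (n + 1)), ← Category.assoc, Limits.comp_zero,
      toSyzygy_comp_syzygyι, hY]
  -- All syzygies are treated at once, since lowering `j` by one replaces the `n`-th syzygy by the
  -- next one.
  suffices h : ∀ j n, Nonempty (Ext (syzygy Q d n) Y j ≃ₗ[k] (Q (n + j + 1) ⟶ Y)) by
    have := h j 0
    rwa [zero_add] at this
  intro j
  induction j with
  | zero =>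
    intro n
    refine ⟨Ext.linearEquiv₀.trans (LinearEquiv.ofBijective
      (Linear.leftComp k Y (toSyzygy Q d hd n)) ⟨?_, ?_⟩)⟩
    · have := epi_toSyzygy hd hex n
      intro f g hfg
      exact (cancel_epi _).mp hfg
    · intro f
      have hS := syzygyComplex_shortExact hd hex n
      have := hS.epi_g
      exact ⟨hS.exact.desc f (hY' n f), hS.exact.g_desc f (hY' n f)⟩
  | succ j ih =>
    intro n
    have hS := syzygyComplex_shortExact hd hex n
    obtain ⟨e⟩ := Ext.nonempty_linearEquiv_succ (k := k) hS (hY' n) j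
    obtain ⟨e'⟩ := ih (n + 1)
    rw [show n + (j + 1) + 1 = n + 1 + j + 1 by omega]
    exact ⟨e.trans e'⟩

end DimensionShifting

end CategoryTheory.Abelian

/-! ### Complete reducibility over a semisimple Lie algebra -/

section CompleteReducibility

open LieAlgebra LieModule

/-- An endomorphism of a finite-dimensional space which is not nilpotent has a nonzero polynomial
multiple which is idempotent. -/
theorem Module.End.exists_isIdempotentElem_mul_aeval {K E : Type*} [Field K] [AddCommGroup E]
    [Module K E] [FiniteDimensional K E] (T : Module.End K E) (hT : ¬ IsNilpotent T) :
    ∃ p : Polynomial K, IsIdempotentElem (T * Polynomial.aeval T p) ∧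
      T * Polynomial.aeval T p ≠ 0 := by
  have hm : minpoly K T ≠ 0 := minpoly.ne_zero (Algebra.IsIntegral.isIntegral T)
  obtain ⟨r, hr, hr'⟩ := Polynomial.exists_eq_pow_rootMultiplicity_mul_and_not_dvd _ hm 0
  rw [map_zero, sub_zero] at hr hr'
  set n := (minpoly K T).rootMultiplicity 0
  -- The minimal polynomial is `Xⁿ r`. From `a Xⁿ⁺¹ + b r = 1` the idempotent is `a(T) Tⁿ⁺¹`, the
  -- projection to the Fitting-one component; the exponent `n + 1` leaves a factor `T` to split off
  -- even if `n = 0`.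
  have hcop : IsCoprime (Polynomial.X ^ (n + 1)) r :=
    ((Polynomial.irreducible_X.coprime_iff_not_dvd).mpr hr').pow_left
  obtain ⟨a, b, hab⟩ := hcop
  have hT0 : T ^ n * Polynomial.aeval T r = 0 := by
    rw [← minpoly.aeval K T, hr, map_mul, map_pow, Polynomial.aeval_X]
  have h1 : Polynomial.aeval T a * T ^ (n + 1) + Polynomial.aeval T b * Polynomial.aeval T r = 1 := by
    simpa using congrArg (Polynomial.aeval T) hab
  have hcomm : ∀ p q : Polynomial K, Commute (Polynomial.aeval T p) (Polynomial.aeval T q) :=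
    fun p q => (Commute.all p q).map (Polynomial.aeval T)
  have hX : ∀ p : Polynomial K, Commute (Polynomial.aeval T p) T := fun p => by
    simpa using hcomm p Polynomial.X
  have he : T * Polynomial.aeval T (a * Polynomial.X ^ n) = Polynomial.aeval T a * T ^ (n + 1) := by
    rw [map_mul, map_pow, Polynomial.aeval_X, ← mul_assoc, ← (hX a).eq, mul_assoc, pow_succ']
  refine ⟨a * Polynomial.X ^ n, ?_, ?_⟩
  · rw [he]
    have h2 : Polynomial.aeval T a * T ^ (n + 1) * (Polynomial.aeval T b * Polynomial.aeval T r)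
        = 0 := by
      rw [(hcomm b r).eq, mul_assoc, pow_succ', mul_assoc T, ← mul_assoc (T ^ n), hT0]
      simp
    have h3 : Polynomial.aeval T b * Polynomial.aeval T r = 1 - Polynomial.aeval T a * T ^ (n + 1) :=
      eq_sub_of_add_eq' h1
    rw [h3, mul_sub, mul_one, sub_eq_zero] at h2
    exact h2.symm
  · rw [he]
    intro h
    rw [h, zero_add] at h1
    refine hT ⟨n, ?_⟩
    rw [← mul_one (T ^ n), ← h1, (hcomm b r).eq, ← mul_assoc, hT0, zero_mul]

variable {L : Type*} [LieRing L] [LieAlgebra ℂ L] [FiniteDimensional ℂ L] [IsKilling ℂ L]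
  (M : Type*) [AddCommGroup M] [Module ℂ M] [LieRingModule L M] [LieModule ℂ L M]

/-- The Casimir operator of `M` twisted by an endomorphism `S` of `L`. -/
noncomputable def twistedCasimir (S : Module.End ℂ L) : Module.End ℂ M :=
  ∑ i, toEnd ℂ L M (S (Module.finBasis ℂ L i)) *
    toEnd ℂ L M ((killingForm ℂ L).dualBasis (IsKilling.killingForm_nondegenerate ℂ L)
      (Module.finBasis ℂ L) i)

omit [FiniteDimensional ℂ L] in
theorem IsKilling.sum_killingForm_smul_dualBasis {ι : Type*} [Fintype ι] [DecidableEq ι]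
    (b : Module.Basis ι ℂ L) (y : L) :
    ∑ j, killingForm ℂ L y (b j) •
      (killingForm ℂ L).dualBasis (IsKilling.killingForm_nondegenerate ℂ L) b j = y := by
  set b' := (killingForm ℂ L).dualBasis (IsKilling.killingForm_nondegenerate ℂ L) b
  conv_rhs => rw [← b'.sum_repr y]
  simp [b']

omit [FiniteDimensional ℂ L] in
theorem IsKilling.repr_eq_killingForm_dualBasis {ι : Type*} [Fintype ι] [DecidableEq ι]
    (b : Module.Basis ι ℂ L) (y : L) (j : ι) :
    b.repr y j = killingForm ℂ L y
      ((killingForm ℂ L).dualBasis (IsKilling.killingForm_nondegenerate ℂ L) b j) := by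
  conv_lhs => rw [← LinearMap.BilinForm.dualBasis_dualBasis
    (IsKilling.killingForm_nondegenerate ℂ L) ⟨traceForm_comm ℂ L L⟩ b]
  rw [LinearMap.BilinForm.dualBasis_repr_apply]

omit [FiniteDimensional ℂ L] in
theorem IsKilling.sum_killingForm_dualBasis_smul {ι : Type*} [Fintype ι] [DecidableEq ι]
    (b : Module.Basis ι ℂ L) (y : L) :
    ∑ j, killingForm ℂ L y ((killingForm ℂ L).dualBasis
      (IsKilling.killingForm_nondegenerate ℂ L) b j) • b j = y := by
  conv_rhs => rw [← b.sum_repr y]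
  simp [IsKilling.repr_eq_killingForm_dualBasis]

/-- Since `S` commutes with the adjoint action, `∑ S bᵢ ⊗ bᵢ'` is an invariant tensor. Expanding
`⁅x, bᵢ⁆` in the basis and `⁅x, bᵢ'⁆` in the dual basis gives two double sums, which cancel by
invariance of the Killing form. -/
theorem toEnd_mul_twistedCasimir (S : Module.End ℂ L) (hS : ∀ x y : L, S ⁅x, y⁆ = ⁅x, S y⁆) (x : L) :
    toEnd ℂ L M x * twistedCasimir M S = twistedCasimir M S * toEnd ℂ L M x := by
  rw [twistedCasimir, Finset.mul_sum, Finset.sum_mul, ← sub_eq_zero, ← Finset.sum_sub_distrib]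
  set b := Module.finBasis ℂ L
  set b' := (killingForm ℂ L).dualBasis (IsKilling.killingForm_nondegenerate ℂ L) b with hb'
  have h : ∀ i, toEnd ℂ L M x * (toEnd ℂ L M (S (b i)) * toEnd ℂ L M (b' i)) -
      toEnd ℂ L M (S (b i)) * toEnd ℂ L M (b' i) * toEnd ℂ L M x =
      (∑ j, killingForm ℂ L ⁅x, b i⁆ (b' j) • (toEnd ℂ L M (S (b j)) * toEnd ℂ L M (b' i))) -
      ∑ j, killingForm ℂ L ⁅x, b j⁆ (b' i) • (toEnd ℂ L M (S (b i)) * toEnd ℂ L M (b' j)) := by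
    intro i
    have h1 : ∑ j, killingForm ℂ L ⁅x, b i⁆ (b' j) •
        (toEnd ℂ L M (S (b j)) * toEnd ℂ L M (b' i)) =
        toEnd ℂ L M ⁅x, S (b i)⁆ * toEnd ℂ L M (b' i) := by
      conv_rhs => rw [← hS, ← IsKilling.sum_killingForm_dualBasis_smul b ⁅x, b i⁆]
      simp only [map_sum, map_smul, Finset.sum_mul, smul_mul_assoc, hb']
    have h2 : ∑ j, killingForm ℂ L ⁅x, b j⁆ (b' i) •
        (toEnd ℂ L M (S (b i)) * toEnd ℂ L M (b' j)) =
        - (toEnd ℂ L M (S (b i)) * toEnd ℂ L M ⁅x, b' i⁆) := by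
      rw [← IsKilling.sum_killingForm_smul_dualBasis b ⁅x, b' i⁆]
      simp only [map_sum, map_smul, Finset.mul_sum, mul_smul_comm, ← Finset.sum_neg_distrib]
      refine Finset.sum_congr rfl fun j _ => ?_
      rw [← neg_smul]
      congr 1
      rw [traceForm_apply_lie_apply', traceForm_comm]
    rw [h1, h2]
    ext m
    simp
  rw [Finset.sum_congr rfl fun i _ => h i, Finset.sum_sub_distrib, Finset.sum_comm, sub_self]

/-- The trace on `M` of `S bᵢ` times `bᵢ'` is `κ(T S bᵢ, bᵢ')`, which is the `i`-th diagonal entry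
of `T S`. -/
theorem trace_twistedCasimir [FiniteDimensional ℂ M] (S T : Module.End ℂ L)
    (hT : ∀ x y, killingForm ℂ L (T x) y = traceForm ℂ L M x y) :
    LinearMap.trace ℂ M (twistedCasimir M S) = LinearMap.trace ℂ L (T * S) := by
  rw [LinearMap.trace_eq_matrix_trace ℂ (Module.finBasis ℂ L), twistedCasimir, map_sum,
    Matrix.trace]
  refine Finset.sum_congr rfl fun i _ => ?_
  rw [Matrix.diag_apply, LinearMap.toMatrix_apply, IsKilling.repr_eq_killingForm_dualBasis,
    Module.End.mul_apply, hT]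
  rfl

/-- Over a semisimple Lie algebra, a module on which all twisted Casimir operators are nilpotent
has zero trace form. -/
theorem traceForm_eq_zero_of_isNilpotent_twistedCasimir [FiniteDimensional ℂ M]
    (h : ∀ S : Module.End ℂ L, (∀ x y : L, S ⁅x, y⁆ = ⁅x, S y⁆) → IsNilpotent (twistedCasimir M S)) :
    traceForm ℂ L M = 0 := by
  have hκ := IsKilling.killingForm_nondegenerate ℂ L
  let T : Module.End ℂ L :=
    ((killingForm ℂ L).toDual hκ).symm.toLinearMap ∘ₗ traceForm ℂ L M
  have hT : ∀ x y, killingForm ℂ L (T x) y = traceForm ℂ L M x y := fun x y => by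
    rw [← LinearMap.BilinForm.toDual_def hκ]
    simp [T]
  have hTlie : ∀ x y : L, T ⁅x, y⁆ = ⁅x, T y⁆ := fun x y => by
    rw [← sub_eq_zero]
    refine hκ.1 _ fun z => ?_
    rw [map_sub, LinearMap.sub_apply, hT, traceForm_apply_lie_apply', traceForm_apply_lie_apply',
      hT, sub_self]
  -- Otherwise some `S = p(T)` makes `T S` a nonzero idempotent. Its trace is that of a nilpotent
  -- twisted Casimir operator, hence zero, and an idempotent of trace zero vanishes in
  -- characteristic zero.
  have hTnil : IsNilpotent T := by
    by_contra hnil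
    obtain ⟨p, hp, hp0⟩ := Module.End.exists_isIdempotentElem_mul_aeval T hnil
    refine hp0 (LinearMap.IsIdempotentElem.eq_zero_of_trace_eq_zero hp ?_)
    rw [← trace_twistedCasimir M _ T hT]
    refine (LinearMap.isNilpotent_trace_of_isNilpotent (h _ fun x y => ?_)).eq_zero
    have hc : Commute T (ad ℂ L x) := LinearMap.ext fun z => hTlie x z
    exact LinearMap.congr_fun (Algebra.commute_of_mem_adjoin_singleton_of_commute
      (Polynomial.aeval_mem_adjoin_singleton ℂ T) hc.symm).eq y |>.symm
  ext x y
  -- The trace form is now the trace of `T (ad x) (ad y)`, which is nilpotent because `T` is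
  -- nilpotent and commutes with the adjoint action.
  rw [← hT, killingForm_apply_apply]
  have hx : ad ℂ L (T x) = T * ad ℂ L x := LinearMap.ext fun z => by
    simp only [ad_apply, Module.End.mul_apply]
    rw [← lie_skew, ← hTlie, ← map_neg, lie_skew]
  have hc : ∀ x, Commute T (ad ℂ L x) := fun x => LinearMap.ext fun z => hTlie x z
  rw [hx, ← Module.End.mul_eq_comp, mul_assoc]
  exact (LinearMap.isNilpotent_trace_of_isNilpotent
    (((hc x).mul_right (hc y)).isNilpotent_mul_right hTnil)).eq_zero

/-- By invariance, an element orthogonal to all brackets under the Killing form is central, and the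
center is zero. -/
theorem IsKilling.top_lie_top : ⁅(⊤ : LieIdeal ℂ L), (⊤ : LieIdeal ℂ L)⁆ = ⊤ := by
  have hκ := IsKilling.killingForm_nondegenerate ℂ L
  rw [← LieSubmodule.toSubmodule_inj, ← Subspace.dualAnnihilator_inj,
    LieSubmodule.top_toSubmodule, Submodule.dualAnnihilator_top, eq_bot_iff]
  intro f hf
  obtain ⟨x, rfl⟩ := ((killingForm ℂ L).toDual hκ).surjective f
  rw [Submodule.mem_dualAnnihilator] at hf
  have hx : x ∈ LieAlgebra.center ℂ L := by
    rw [LieModule.mem_maxTrivSubmodule]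
    intro y
    refine hκ.1 _ fun z => ?_
    rw [traceForm_apply_lie_apply', neg_eq_zero]
    exact hf _ (LieSubmodule.lie_mem_lie (LieSubmodule.mem_top y) (LieSubmodule.mem_top z))
  rw [LieAlgebra.center_eq_bot, LieSubmodule.mem_bot] at hx
  rw [hx, map_zero]
  exact Submodule.zero_mem _

/-- A module over a semisimple Lie algebra with zero trace form is trivial. -/
theorem lie_eq_zero_of_traceForm_eq_zero [FiniteDimensional ℂ M] (h : traceForm ℂ L M = 0)
    (x : L) (m : M) : ⁅x, m⁆ = 0 := by
  have hn := isNilpotent_derivedSeries_of_traceForm_eq_zero h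
  have htop : derivedSeries ℂ L 1 = ⊤ := by
    rw [derivedSeries_def, derivedSeriesOfIdeal_succ, derivedSeriesOfIdeal_zero,
      IsKilling.top_lie_top]
  have hL : LieModule.IsNilpotent L M := by
    rw [isNilpotent_iff_forall' (R := ℂ)] at hn ⊢
    exact fun x => hn ⟨x, htop ▸ LieSubmodule.mem_top x⟩
  obtain ⟨k, hk⟩ := (LieModule.isNilpotent_iff ℂ L M).mp hL
  -- As `L` is perfect, `⁅L, M⁆ = ⁅⁅L, L⁆, M⁆ ⊆ ⁅L, ⁅L, M⁆⁆`. The lower central series therefore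
  -- never drops below `⁅L, M⁆`, and nilpotency forces `⁅L, M⁆ = 0`.
  have hlcs : ∀ k, ⁅(⊤ : LieIdeal ℂ L), (⊤ : LieSubmodule ℂ L M)⁆ ≤
      lowerCentralSeries ℂ L M k := by
    intro k
    induction k with
    | zero => exact le_top
    | succ k ih =>
      rw [lowerCentralSeries_succ]
      refine le_trans ?_ (LieSubmodule.mono_lie_right _ ih)
      conv_lhs => rw [← IsKilling.top_lie_top]
      rw [LieSubmodule.lieIdeal_oper_eq_span, LieSubmodule.lieSpan_le]
      rintro _ ⟨⟨y, hy⟩, ⟨m, -⟩, rfl⟩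
      change ⁅y, m⁆ ∈ _
      rw [SetLike.mem_coe, ← LieSubmodule.mem_toSubmodule]
      revert hy
      rw [← LieSubmodule.mem_toSubmodule, LieSubmodule.lieIdeal_oper_eq_linear_span]
      intro hy
      induction hy using Submodule.span_induction with
      | mem z hz =>
        obtain ⟨⟨a, -⟩, ⟨b, -⟩, rfl⟩ := hz
        change ⁅⁅a, b⁆, m⁆ ∈ _
        rw [lie_lie]
        exact sub_mem
          (LieSubmodule.lie_mem_lie (LieSubmodule.mem_top a)
            (LieSubmodule.lie_mem_lie (LieSubmodule.mem_top b) (LieSubmodule.mem_top m)))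
          (LieSubmodule.lie_mem_lie (LieSubmodule.mem_top b)
            (LieSubmodule.lie_mem_lie (LieSubmodule.mem_top a) (LieSubmodule.mem_top m)))
      | zero => rw [zero_lie]; exact zero_mem _
      | add a b _ _ ha hb => rw [add_lie]; exact add_mem ha hb
      | smul c a _ ha => rw [smul_lie]; exact Submodule.smul_mem _ c ha
  have := hlcs k (LieSubmodule.lie_mem_lie (LieSubmodule.mem_top x) (LieSubmodule.mem_top m))
  rwa [hk, LieSubmodule.mem_bot] at this

/-- A finite-dimensional module `M` over a semisimple Lie algebra `L` is the sum of its invariants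
and of `⁅L, M⁆`. -/
theorem maxTrivSubmodule_sup_lie_eq_top (n : ℕ) :
    ∀ (M : Type*) [AddCommGroup M] [Module ℂ M] [LieRingModule L M] [LieModule ℂ L M]
      [FiniteDimensional ℂ M], Module.finrank ℂ M = n →
      maxTrivSubmodule ℂ L M ⊔ ⁅(⊤ : LieIdeal ℂ L), (⊤ : LieSubmodule ℂ L M)⁆ = ⊤ := by
  induction n using Nat.strong_induction_on with
  | _ n ih =>
  intro M _ _ _ _ _ hM
  by_cases h : ∀ S : Module.End ℂ L, (∀ x y : L, S ⁅x, y⁆ = ⁅x, S y⁆) →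
      _root_.IsNilpotent (twistedCasimir M S)
  · have h0 := lie_eq_zero_of_traceForm_eq_zero M
      (traceForm_eq_zero_of_isNilpotent_twistedCasimir M h)
    rw [eq_top_iff]
    exact fun m _ => LieSubmodule.mem_sup_left ((mem_maxTrivSubmodule ℂ L M m).mpr (h0 · m))
  push Not at h
  obtain ⟨S, hS, hnil⟩ := h
  set C := twistedCasimir M S
  -- Fitting decomposition for a non-nilpotent `C`: the kernel of `C ^ k` is a proper submodule,
  -- covered by induction. The condition `k ≥ 1` puts the range inside `⁅L, M⁆`, because `C` is a
  -- sum of products of action operators.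
  obtain ⟨k, hk, hk1⟩ := (C.eventually_isCompl_ker_pow_range_pow.and
    (Filter.eventually_ge_atTop 1)).exists
  have hC : ∀ (x : L) (m : M), (C ^ k) ⁅x, m⁆ = ⁅x, (C ^ k) m⁆ := fun x m => by
    have : Commute (toEnd ℂ L M x) (C ^ k) :=
      Commute.pow_right (toEnd_mul_twistedCasimir M S hS x) k
    exact (LinearMap.congr_fun this.eq m).symm
  let N : LieSubmodule ℂ L M :=
    { LinearMap.ker (C ^ k) with
      lie_mem := fun {x m} hm => by
        change (C ^ k) ⁅x, m⁆ = 0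
        rw [hC, LinearMap.mem_ker.mp hm, lie_zero] }
  have hN : Module.finrank ℂ N < n := by
    rw [← hM]
    refine Submodule.finrank_lt (s := LinearMap.ker (C ^ k)) fun htop => hnil ⟨k, ?_⟩
    exact LinearMap.ker_eq_top.mp htop
  have hNsup := ih _ hN N rfl
  rw [eq_top_iff]
  intro m _
  obtain ⟨a, ha, _, ⟨b, rfl⟩, rfl⟩ :=
    Submodule.mem_sup.mp (hk.sup_eq_top ▸ Submodule.mem_top : m ∈ _)
  refine add_mem ?_ ?_
  · have haN : (⟨a, ha⟩ : N) ∈ (⊤ : LieSubmodule ℂ L N) := LieSubmodule.mem_top _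
    rw [← hNsup, LieSubmodule.mem_sup] at haN
    obtain ⟨u, hu, v, hv, huv⟩ := haN
    have huv' : (u : M) + (v : M) = a := congrArg Subtype.val huv
    rw [← huv']
    refine add_mem (LieSubmodule.mem_sup_left ?_) (LieSubmodule.mem_sup_right ?_)
    · rw [mem_maxTrivSubmodule] at hu ⊢
      exact fun x => congrArg Subtype.val (hu x)
    · have := LieSubmodule.mem_map_of_mem (f := N.incl) hv
      rw [LieSubmodule.map_bracket_eq] at this
      exact LieSubmodule.mono_lie_right _ le_top this
  · refine LieSubmodule.mem_sup_right ?_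
    obtain ⟨l, rfl⟩ : ∃ l, k = l + 1 := ⟨k - 1, by omega⟩
    rw [pow_succ', Module.End.mul_apply, show C = twistedCasimir M S from rfl, twistedCasimir,
      LinearMap.sum_apply]
    exact sum_mem fun i _ =>
      LieSubmodule.lie_mem_lie (LieSubmodule.mem_top _) (LieSubmodule.mem_top _)

variable {M} {N : Type*} [AddCommGroup N] [Module ℂ N] [LieRingModule L N] [LieModule ℂ L N]

/-- Invariants lift along surjections of finite-dimensional modules over a semisimple Lie
algebra. -/
theorem exists_mem_maxTrivSubmodule_map_eq [FiniteDimensional ℂ M] (f : M →ₗ⁅ℂ, L⁆ N)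
    (hf : Function.Surjective f) {n : N} (hn : n ∈ maxTrivSubmodule ℂ L N) :
    ∃ m ∈ maxTrivSubmodule ℂ L M, f m = n := by
  rw [mem_maxTrivSubmodule] at hn
  -- On the preimage of the line through `n` every bracket is killed by `f`, since `L` kills that
  -- line. Hence the invariant component of any preimage of `n` still maps to `n`.
  let P : LieSubmodule ℂ L M :=
    { Submodule.comap (f : M →ₗ[ℂ] N) (ℂ ∙ n) with
      lie_mem := fun {x m} hm => by
        obtain ⟨c, hc⟩ := Submodule.mem_span_singleton.mp (Submodule.mem_comap.mp hm)
        refine Submodule.mem_comap.mpr ?_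
        have hc' : f m = c • n := hc.symm
        rw [LieModuleHom.coe_toLinearMap, LieModuleHom.map_lie, hc', lie_smul, hn, smul_zero]
        exact zero_mem _ }
  obtain ⟨m, rfl⟩ := hf n
  have hm : (⟨m, Submodule.mem_span_singleton_self (f m)⟩ : P) ∈ (⊤ : LieSubmodule ℂ L P) :=
    LieSubmodule.mem_top _
  rw [← maxTrivSubmodule_sup_lie_eq_top _ P rfl, LieSubmodule.mem_sup] at hm
  obtain ⟨u, hu, v, hv, huv⟩ := hm
  refine ⟨u, (mem_maxTrivSubmodule _ _ _ _).mpr fun x => congrArg Subtype.val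
    ((mem_maxTrivSubmodule _ _ _ _).mp hu x), ?_⟩
  have hv0 : f (v : M) = 0 := by
    suffices h : ⁅(⊤ : LieIdeal ℂ L), (⊤ : LieSubmodule ℂ L P)⁆ ≤ (f.comp P.incl).ker from
      LieModuleHom.mem_ker.mp (h hv)
    rw [LieSubmodule.lieIdeal_oper_eq_span, LieSubmodule.lieSpan_le]
    rintro _ ⟨⟨x, -⟩, ⟨p, -⟩, rfl⟩
    refine LieModuleHom.mem_ker.mpr ?_
    obtain ⟨c, hc⟩ := Submodule.mem_span_singleton.mp (Submodule.mem_comap.mp p.2)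
    have hc' : f p = c • f m := hc.symm
    change f ⁅x, (p : M)⁆ = 0
    rw [LieModuleHom.map_lie, hc', lie_smul, hn, smul_zero]
  have huv' : (u : M) + (v : M) = m := congrArg Subtype.val huv
  rw [← huv', map_add, hv0, add_zero]

/-- Homomorphisms from a finite-dimensional module over a semisimple Lie algebra lift along
surjections of finite-dimensional modules. -/
theorem exists_lieModuleHom_comp_eq {S : Type*} [AddCommGroup S] [Module ℂ S] [LieRingModule L S]
    [LieModule ℂ L S] [FiniteDimensional ℂ S] [FiniteDimensional ℂ M] (f : M →ₗ⁅ℂ, L⁆ N)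
    (hf : Function.Surjective f) (g : S →ₗ⁅ℂ, L⁆ N) : ∃ h : S →ₗ⁅ℂ, L⁆ M, f.comp h = g := by
  -- The `L`-module maps are the invariants in the space of linear maps, so it suffices to lift an
  -- invariant along composition with `f`. This is surjective because `f` has a linear section.
  let F : (S →ₗ[ℂ] M) →ₗ⁅ℂ, L⁆ (S →ₗ[ℂ] N) :=
    { LinearMap.llcomp ℂ S M N (f : M →ₗ[ℂ] N) with
      map_lie' := fun {x φ} => LinearMap.ext fun s => by simp }
  have hF : Function.Surjective F := fun φ => by
    obtain ⟨σ, hσ⟩ := (f : M →ₗ[ℂ] N).exists_rightInverse_of_surjective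
      (LinearMap.range_eq_top.mpr hf)
    exact ⟨σ ∘ₗ φ, LinearMap.ext fun s => LinearMap.congr_fun hσ (φ s)⟩
  obtain ⟨φ, hφ, hφg⟩ := exists_mem_maxTrivSubmodule_map_eq F hF
    (maxTrivLinearMapEquivLieModuleHom.symm g).2
  refine ⟨maxTrivLinearMapEquivLieModuleHom ⟨φ, hφ⟩, LieModuleHom.ext fun s => ?_⟩
  exact LinearMap.congr_fun hφg s

end CompleteReducibility

/-! ### Exterior multiplication and contraction -/

section ExteriorOperators

variable {M : Type*} [AddCommGroup M] [Module ℂ M]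

theorem ExteriorAlgebra.ι_mul_mem_exteriorPower (v : M) {n : ℕ} {x : ExteriorAlgebra ℂ M}
    (hx : x ∈ ⋀[ℂ]^n M) : ExteriorAlgebra.ι ℂ v * x ∈ ⋀[ℂ]^(n + 1) M := by
  change _ ∈ LinearMap.range (ExteriorAlgebra.ι ℂ) ^ (n + 1)
  rw [pow_succ']
  exact Submodule.mul_mem_mul (LinearMap.mem_range_self _ v) hx

/-- The contraction of elements of the exterior algebra with a linear form. -/
noncomputable def exteriorContract (f : Module.Dual ℂ M) :
    ExteriorAlgebra ℂ M →ₗ[ℂ] ExteriorAlgebra ℂ M :=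
  CliffordAlgebra.contractLeft (Q := (0 : QuadraticForm ℂ M)) f

theorem exteriorContract_ι_mul (f : Module.Dual ℂ M) (v : M) (x : ExteriorAlgebra ℂ M) :
    exteriorContract f (ExteriorAlgebra.ι ℂ v * x) =
      f v • x - ExteriorAlgebra.ι ℂ v * exteriorContract f x :=
  CliffordAlgebra.contractLeft_ι_mul (Q := (0 : QuadraticForm ℂ M)) f v x

theorem exteriorContract_eq_zero_of_mem (f : Module.Dual ℂ M) {x : ExteriorAlgebra ℂ M}
    (hx : x ∈ ⋀[ℂ]^0 M) : exteriorContract f x = 0 := by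
  change x ∈ LinearMap.range (ExteriorAlgebra.ι ℂ) ^ 0 at hx
  rw [pow_zero] at hx
  obtain ⟨c, rfl⟩ := Submodule.mem_one.mp hx
  exact CliffordAlgebra.contractLeft_algebraMap (Q := (0 : QuadraticForm ℂ M)) f c

theorem exteriorPower_succ_induction {n : ℕ} {p : ExteriorAlgebra ℂ M → Prop}
    (hι : ∀ v, ∀ y ∈ ⋀[ℂ]^n M, p (ExteriorAlgebra.ι ℂ v * y))
    (hadd : ∀ x y, p x → p y → p (x + y)) {x : ExteriorAlgebra ℂ M}
    (hx : x ∈ ⋀[ℂ]^(n + 1) M) : p x := by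
  change x ∈ LinearMap.range (ExteriorAlgebra.ι ℂ) ^ (n + 1) at hx
  rw [pow_succ'] at hx
  refine Submodule.mul_induction_on hx ?_ hadd
  rintro _ ⟨v, rfl⟩ y hy
  exact hι v y hy

theorem exteriorContract_mem (f : Module.Dual ℂ M) (n : ℕ) {x : ExteriorAlgebra ℂ M}
    (hx : x ∈ ⋀[ℂ]^(n + 1) M) : exteriorContract f x ∈ ⋀[ℂ]^n M := by
  induction n generalizing x with
  | zero =>
    refine exteriorPower_succ_induction (p := fun x => exteriorContract f x ∈ _) (fun v y hy => ?_)
      (fun x y hx hy => by rw [map_add]; exact add_mem hx hy) hx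
    rw [exteriorContract_ι_mul, exteriorContract_eq_zero_of_mem f hy, mul_zero, sub_zero]
    exact Submodule.smul_mem _ _ hy
  | succ n ih =>
    refine exteriorPower_succ_induction (p := fun x => exteriorContract f x ∈ _) (fun v y hy => ?_)
      (fun x y hx hy => by rw [map_add]; exact add_mem hx hy) hx
    rw [exteriorContract_ι_mul]
    exact sub_mem (Submodule.smul_mem _ _ hy)
      (ExteriorAlgebra.ι_mul_mem_exteriorPower v (ih hy))

namespace exteriorPower

/-- Exterior multiplication with a vector. -/
noncomputable def wedge (n : ℕ) (v : M) : ⋀[ℂ]^n M →ₗ[ℂ] ⋀[ℂ]^(n + 1) M :=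
  (LinearMap.mulLeft ℂ (ExteriorAlgebra.ι ℂ v)).restrict
    fun _ hx => ExteriorAlgebra.ι_mul_mem_exteriorPower v hx

/-- Contraction with a linear form. -/
noncomputable def contract (n : ℕ) (f : Module.Dual ℂ M) : ⋀[ℂ]^(n + 1) M →ₗ[ℂ] ⋀[ℂ]^n M :=
  (exteriorContract f).restrict fun _ hx => exteriorContract_mem f n hx

theorem linearMap_ext_wedge {N : Type*} [AddCommGroup N] [Module ℂ N] {n : ℕ}
    {f g : ⋀[ℂ]^(n + 1) M →ₗ[ℂ] N} (h : ∀ v y, f (wedge n v y) = g (wedge n v y)) : f = g := by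
  refine LinearMap.ext fun x => ?_
  refine (exteriorPower_succ_induction (p := fun x => ∃ hx : x ∈ ⋀[ℂ]^(n + 1) M,
    f ⟨x, hx⟩ = g ⟨x, hx⟩) (fun v y hy => ⟨_, h v ⟨y, hy⟩⟩) ?_ x.2).2
  rintro x y ⟨hx, hfx⟩ ⟨hy, hfy⟩
  refine ⟨add_mem hx hy, ?_⟩
  have := congrArg₂ (· + ·) hfx hfy
  rwa [← map_add, ← map_add] at this

theorem contract_wedge_zero (f : Module.Dual ℂ M) (v : M) (x : ⋀[ℂ]^0 M) :
    contract 0 f (wedge 0 v x) = f v • x := by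
  refine Subtype.ext ((exteriorContract_ι_mul f v x).trans ?_)
  rw [exteriorContract_eq_zero_of_mem f x.2, mul_zero, sub_zero]
  rfl

theorem contract_wedge {n : ℕ} (f : Module.Dual ℂ M) (v : M) (x : ⋀[ℂ]^(n + 1) M) :
    contract (n + 1) f (wedge (n + 1) v x) = f v • x - wedge n v (contract n f x) :=
  Subtype.ext (exteriorContract_ι_mul f v x)

theorem contract_contract {n : ℕ} (f g : Module.Dual ℂ M) (x : ⋀[ℂ]^(n + 1 + 1) M) :
    contract n f (contract (n + 1) g x) = - contract n g (contract (n + 1) f x) :=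
  Subtype.ext (CliffordAlgebra.contractLeft_comm (Q := (0 : QuadraticForm ℂ M)) f g _)

theorem contract_add (n : ℕ) (f g : Module.Dual ℂ M) :
    contract n (f + g) = contract n f + contract n g := by
  refine LinearMap.ext fun x => Subtype.ext ?_
  change exteriorContract (f + g) _ = _
  simp only [exteriorContract, map_add]
  rfl

theorem contract_smul (n : ℕ) (c : ℂ) (f : Module.Dual ℂ M) :
    contract n (c • f) = c • contract n f := by
  refine LinearMap.ext fun x => Subtype.ext ?_
  change exteriorContract (c • f) _ = _
  simp only [exteriorContract, map_smul]
  rfl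

/-- Contraction, as a linear map in the linear form. -/
noncomputable def contractₗ (n : ℕ) :
    Module.Dual ℂ M →ₗ[ℂ] ⋀[ℂ]^(n + 1) M →ₗ[ℂ] ⋀[ℂ]^n M where
  toFun := contract n
  map_add' := contract_add n
  map_smul' := contract_smul n

/-- This is the Euler operator of the exterior algebra. On `v ∧ y` the Leibniz rule for contraction
yields `v ∧ y` plus `v` wedged with the same operator on `y`, so each factor contributes one. -/
theorem sum_wedge_contract {ι : Type*} [Fintype ι] (b : Module.Basis ι ℂ M) (n : ℕ)
    (x : ⋀[ℂ]^(n + 1) M) :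
    ∑ i, wedge n (b i) (contract n (b.coord i) x) = ((n : ℂ) + 1) • x := by
  suffices h : ∑ i, wedge n (b i) ∘ₗ contract n (b.coord i) = ((n : ℂ) + 1) • LinearMap.id by
    simpa using LinearMap.congr_fun h x
  clear x
  have hv : ∀ v, (∑ i, b.coord i v • ExteriorAlgebra.ι ℂ (b i)) = ExteriorAlgebra.ι ℂ v := by
    intro v
    simp only [← map_smul, ← map_sum, Module.Basis.coord_apply, b.sum_repr]
  induction n with
  | zero =>
    refine linearMap_ext_wedge fun v y => Subtype.ext ?_
    simp only [LinearMap.sum_apply, LinearMap.comp_apply, contract_wedge_zero, map_smul]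
    rw [AddSubmonoidClass.coe_finsetSum]
    change ∑ i, b.coord i v • (ExteriorAlgebra.ι ℂ (b i) * (y : ExteriorAlgebra ℂ M)) = _
    simp only [← smul_mul_assoc, ← Finset.sum_mul, hv]
    rw [Nat.cast_zero, LinearMap.smul_apply, show ((0 : ℂ) + 1) = 1 from zero_add 1, one_smul]
    rfl
  | succ n ih =>
    refine linearMap_ext_wedge fun v y => ?_
    have ih' := LinearMap.congr_fun ih y
    simp only [LinearMap.sum_apply, LinearMap.comp_apply, contract_wedge, map_sub, map_smul,
      Finset.sum_sub_distrib] at ih' ⊢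
    have h1 : ∑ i, b.coord i v • wedge (n + 1) (b i) y = wedge (n + 1) v y := by
      refine Subtype.ext ?_
      rw [AddSubmonoidClass.coe_finsetSum]
      change ∑ i, b.coord i v • (ExteriorAlgebra.ι ℂ (b i) * (y : ExteriorAlgebra ℂ M)) =
        ExteriorAlgebra.ι ℂ v * (y : ExteriorAlgebra ℂ M)
      simp only [← smul_mul_assoc, ← Finset.sum_mul, hv]
    have h2 : ∀ (u w : M) (z : ⋀[ℂ]^n M),
        wedge (n + 1) u (wedge n w z) = - wedge (n + 1) w (wedge n u z) := by
      intro u w z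
      refine Subtype.ext ?_
      change ExteriorAlgebra.ι ℂ u * (ExteriorAlgebra.ι ℂ w * (z : ExteriorAlgebra ℂ M)) =
        - (ExteriorAlgebra.ι ℂ w * (ExteriorAlgebra.ι ℂ u * (z : ExteriorAlgebra ℂ M)))
      rw [← mul_assoc, ← mul_assoc, ← neg_mul]
      congr 1
      exact eq_neg_of_add_eq_zero_left (ExteriorAlgebra.ι_add_mul_swap u w)
    rw [h1, Finset.sum_congr rfl fun i _ => h2 (b i) v _, Finset.sum_neg_distrib, ← map_sum, ih',
      sub_neg_eq_add]
    simp only [LinearMap.smul_apply, LinearMap.id_apply, map_smul, Nat.cast_add, Nat.cast_one]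
    module

variable {L : Type*} [LieRing L] [LieAlgebra ℂ L] [LieRingModule L M] [LieModule ℂ L M]

theorem lie_ιMulti (n : ℕ) (x : L) (v : Fin n → M) :
    ⁅x, ιMulti ℂ n v⁆ = ∑ i, ιMulti ℂ n (Function.update v i ⁅x, v i⁆) :=
  wedgeDeriv_ιMulti n _ v

theorem wedge_ιMulti (n : ℕ) (v : M) (w : Fin n → M) :
    wedge n v (ιMulti ℂ n w) = ιMulti ℂ (n + 1) (Fin.cons v w : Fin (n + 1) → M) := by
  refine Subtype.ext ?_
  rw [ιMulti_apply_coe, ExteriorAlgebra.ιMulti_succ_apply]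
  rfl

theorem lie_wedge (n : ℕ) (x : L) (v : M) (y : ⋀[ℂ]^n M) :
    ⁅x, wedge n v y⁆ = wedge n ⁅x, v⁆ y + wedge n v ⁅x, y⁆ := by
  suffices h : (LieModule.toEnd ℂ L (⋀[ℂ]^(n + 1) M) x : _ →ₗ[ℂ] _) ∘ₗ wedge n v =
      wedge n ⁅x, v⁆ + wedge n v ∘ₗ (LieModule.toEnd ℂ L (⋀[ℂ]^n M) x) from
    LinearMap.congr_fun h y
  refine linearMap_ext (AlternatingMap.ext fun w => ?_)
  simp only [LinearMap.compAlternatingMap_apply, LinearMap.comp_apply, LinearMap.add_apply,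
    LieModule.toEnd_apply_apply, wedge_ιMulti, lie_ιMulti, map_sum, Fin.sum_univ_succ,
    Fin.cons_zero, Fin.cons_succ, Fin.update_cons_zero, Fin.cons_update]

/-- Contraction is equivariant: the subtracted term is the dual action `x • f = -f ∘ x`. -/
theorem lie_contract (n : ℕ) (x : L) (f : Module.Dual ℂ M) (y : ⋀[ℂ]^(n + 1) M) :
    ⁅x, contract n f y⁆ =
      contract n f ⁅x, y⁆ - contract n (f ∘ₗ LieModule.toEnd ℂ L M x) y := by
  suffices h : (LieModule.toEnd ℂ L (⋀[ℂ]^n M) x : _ →ₗ[ℂ] _) ∘ₗ contract n f =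
      contract n f ∘ₗ (LieModule.toEnd ℂ L (⋀[ℂ]^(n + 1) M) x) -
        contract n (f ∘ₗ LieModule.toEnd ℂ L M x) from
    LinearMap.congr_fun h y
  clear y
  induction n with
  | zero =>
    refine linearMap_ext_wedge fun v y => ?_
    simp [contract_wedge_zero, lie_wedge]
  | succ n ih =>
    refine linearMap_ext_wedge fun v z => ?_
    have ih' := LinearMap.congr_fun ih z
    simp only [LinearMap.comp_apply, LinearMap.sub_apply, LieModule.toEnd_apply_apply,
      contract_wedge, lie_wedge, lie_sub, map_add] at ih' ⊢
    rw [ih', map_sub, show ⁅x, f v • z⁆ = f v • ⁅x, z⁆ from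
      map_smul (LieModule.toEnd ℂ L (⋀[ℂ]^(n + 1) M) x) (f v) z]
    abel

end exteriorPower

end ExteriorOperators

/-! ### The symmetric algebra, its grading and its derivations -/

section PolynomialAlgebra

variable (V : Type u) [AddCommGroup V] [Module ℂ V]

/-- The symmetric algebra of `V`, as the algebra of polynomials in the elements of a basis. -/
abbrev PolyAlg : Type := MvPolynomial (Fin (Module.finrank ℂ V)) ℂ

/-- The subspace of homogeneous polynomials of a degree in `ℤ`. -/
noncomputable def polyHomogeneous : ℤ → Submodule ℂ (PolyAlg V)
  | Int.ofNat n => MvPolynomial.homogeneousSubmodule _ ℂ n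
  | Int.negSucc _ => ⊥

/-- The homogeneous component of a degree in `ℤ`. -/
noncomputable def polyComponent : ℤ → PolyAlg V →ₗ[ℂ] PolyAlg V
  | Int.ofNat n => MvPolynomial.homogeneousComponent n
  | Int.negSucc _ => 0

variable {V}

theorem mem_polyHomogeneous_natCast {n : ℕ} {p : PolyAlg V} :
    p ∈ polyHomogeneous V n ↔ p.IsHomogeneous n := Iff.rfl

/-- Integer degrees match the grading of modules; negative ones contain only zero, so the usual
homogeneous polynomials remain. -/
theorem polyHomogeneous_induction {k : ℤ} {p : PolyAlg V} (hp : p ∈ polyHomogeneous V k)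
    {motive : ℤ → PolyAlg V → Prop} (zero : motive k 0)
    (natCast : ∀ (n : ℕ) (p : PolyAlg V), p.IsHomogeneous n → motive n p) : motive k p := by
  cases k with
  | ofNat n => exact natCast n p hp
  | negSucc n =>
    obtain rfl : p = 0 := hp
    exact zero

theorem polyComponent_mem (k : ℤ) (p : PolyAlg V) : polyComponent V k p ∈ polyHomogeneous V k := by
  cases k with
  | ofNat n => exact MvPolynomial.homogeneousComponent_mem n p
  | negSucc n => exact zero_mem _

theorem polyComponent_of_mem {k l : ℤ} {p : PolyAlg V} (hp : p ∈ polyHomogeneous V l) :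
    polyComponent V k p = if k = l then p else 0 := by
  refine polyHomogeneous_induction (motive := fun l p => polyComponent V k p =
    if k = l then p else 0) hp (by simp) fun n p hp => ?_
  cases k with
  | ofNat m =>
    refine (MvPolynomial.homogeneousComponent_of_mem hp).trans ?_
    simp
  | negSucc m =>
    rw [if_neg (by omega)]
    rfl

theorem exists_sum_polyComponent (p : PolyAlg V) :
    ∃ S : Finset ℤ, ∀ T : Finset ℤ, S ⊆ T → p = ∑ k ∈ T, polyComponent V k p := by
  refine ⟨(Finset.range (p.totalDegree + 1)).map Nat.castEmbedding, fun T hT => ?_⟩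
  have h : p = ∑ k ∈ (Finset.range (p.totalDegree + 1)).map Nat.castEmbedding,
      polyComponent V k p := by
    rw [Finset.sum_map]
    exact p.sum_homogeneousComponent.symm
  refine h.trans (Finset.sum_subset hT fun k _ hk => ?_)
  rw [h, map_sum]
  refine Finset.sum_eq_zero fun l hl => ?_
  rw [polyComponent_of_mem (polyComponent_mem l p), if_neg]
  rintro rfl
  exact hk hl

instance (k : ℤ) : FiniteDimensional ℂ (LinearMap.range (polyComponent V k)) := by
  have : FiniteDimensional ℂ (polyHomogeneous V k) := by
    cases k with
    | ofNat n => exact Module.Finite.iff_fg.mpr (MvPolynomial.homogeneousSubmodule_fg _ ℂ n)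
    | negSucc n => exact inferInstanceAs (FiniteDimensional ℂ (⊥ : Submodule ℂ (PolyAlg V)))
  exact Submodule.finiteDimensional_of_le (S₂ := polyHomogeneous V k) (by
    rintro _ ⟨p, rfl⟩
    exact polyComponent_mem k p)

variable [FiniteDimensional ℂ V]

/-- A vector, as a linear polynomial. -/
noncomputable def linearPoly : V →ₗ[ℂ] PolyAlg V :=
  (Module.finBasis ℂ V).constr ℂ MvPolynomial.X

@[simp]
theorem linearPoly_finBasis (i : Fin (Module.finrank ℂ V)) :
    linearPoly (Module.finBasis ℂ V i) = MvPolynomial.X i :=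
  (Module.finBasis ℂ V).constr_basis ℂ _ i

theorem linearPoly_apply (v : V) :
    linearPoly v = ∑ i, (Module.finBasis ℂ V).repr v i • MvPolynomial.X i :=
  (Module.finBasis ℂ V).constr_apply_fintype ℂ _ v

theorem isHomogeneous_linearPoly (v : V) : (linearPoly v).IsHomogeneous 1 := by
  rw [linearPoly_apply, ← MvPolynomial.mem_homogeneousSubmodule]
  exact sum_mem fun i _ => Submodule.smul_mem _ _ (MvPolynomial.isHomogeneous_X ℂ i)

variable {L : Type u} [LieRing L] [LieRingModule L V]

/-- The action of a Lie algebra on the symmetric algebra of a module, by derivations. -/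
noncomputable def polyDeriv (x : L) : Derivation ℂ (PolyAlg V) (PolyAlg V) :=
  ∑ i, linearPoly ⁅x, Module.finBasis ℂ V i⁆ • MvPolynomial.pderiv i

theorem polyDeriv_apply (x : L) (p : PolyAlg V) :
    polyDeriv x p = ∑ i, linearPoly ⁅x, Module.finBasis ℂ V i⁆ * MvPolynomial.pderiv i p := by
  have h := map_sum (Derivation.coeFnAddMonoidHom (R := ℂ) (A := PolyAlg V) (M := PolyAlg V))
    (fun i => linearPoly ⁅x, Module.finBasis ℂ V i⁆ • MvPolynomial.pderiv i) Finset.univ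
  refine (congrFun h p).trans ?_
  rw [Finset.sum_apply]
  rfl

theorem polyDeriv_X (x : L) (i : Fin (Module.finrank ℂ V)) :
    polyDeriv x (MvPolynomial.X i : PolyAlg V) = linearPoly ⁅x, Module.finBasis ℂ V i⁆ := by
  classical
  rw [polyDeriv_apply, Finset.sum_eq_single i]
  · rw [MvPolynomial.pderiv_X_self, mul_one]
  · intro j _ hj
    rw [MvPolynomial.pderiv_X_of_ne hj.symm, mul_zero]
  · simp

theorem polyDeriv_add (x y : L) :
    (polyDeriv (x + y) : Derivation ℂ (PolyAlg V) (PolyAlg V)) = polyDeriv x + polyDeriv y := by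
  refine MvPolynomial.derivation_ext fun i => ?_
  rw [Derivation.add_apply, polyDeriv_X, polyDeriv_X, polyDeriv_X, add_lie, map_add]

theorem polyDeriv_mem (x : L) {k : ℤ} {p : PolyAlg V} (hp : p ∈ polyHomogeneous V k) :
    polyDeriv x p ∈ polyHomogeneous V k := by
  refine polyHomogeneous_induction (motive := fun k p => polyDeriv x p ∈ polyHomogeneous V k) hp
    (by rw [map_zero]; exact zero_mem _) fun n p hp => ?_
  rw [polyDeriv_apply]
  refine sum_mem fun i _ => ?_
  cases n with
  | zero =>
    rw [MvPolynomial.totalDegree_eq_zero_iff_eq_C.mp (Nat.le_zero.mp hp.totalDegree_le),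
      MvPolynomial.pderiv_C, mul_zero]
    exact zero_mem _
  | succ n =>
    rw [mem_polyHomogeneous_natCast, add_comm]
    exact (isHomogeneous_linearPoly _).mul hp.pderiv

variable [LieAlgebra ℂ L] [LieModule ℂ L V]

theorem polyDeriv_linearPoly (x : L) (v : V) :
    polyDeriv x (linearPoly v) = linearPoly ⁅x, v⁆ := by
  suffices h : (polyDeriv x : Derivation ℂ (PolyAlg V) (PolyAlg V)).toLinearMap ∘ₗ linearPoly =
      linearPoly ∘ₗ (LieModule.toEnd ℂ L V x) from LinearMap.congr_fun h v
  refine (Module.finBasis ℂ V).ext fun i => ?_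
  simp [polyDeriv_X]

theorem polyDeriv_lie (x y : L) :
    (polyDeriv ⁅x, y⁆ : Derivation ℂ (PolyAlg V) (PolyAlg V)) =
      ⁅polyDeriv (V := V) x, polyDeriv (V := V) y⁆ := by
  refine MvPolynomial.derivation_ext fun i => ?_
  rw [Derivation.commutator_apply, polyDeriv_X, polyDeriv_X, polyDeriv_X, polyDeriv_linearPoly,
    polyDeriv_linearPoly, lie_lie, map_sub]

theorem polyDeriv_smul (c : ℂ) (x : L) :
    (polyDeriv (c • x) : Derivation ℂ (PolyAlg V) (PolyAlg V)) = c • polyDeriv x := by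
  refine MvPolynomial.derivation_ext fun i => ?_
  rw [Derivation.smul_apply, polyDeriv_X, polyDeriv_X, smul_lie, map_smul]

theorem linearPoly_mul_mem (v : V) {k : ℤ} {p : PolyAlg V} (hp : p ∈ polyHomogeneous V k) :
    linearPoly v * p ∈ polyHomogeneous V (k + 1) := by
  refine polyHomogeneous_induction (motive := fun k p => linearPoly v * p ∈
    polyHomogeneous V (k + 1)) hp (by rw [mul_zero]; exact zero_mem _) fun n p hp => ?_
  rw [← Nat.cast_succ, mem_polyHomogeneous_natCast, Nat.succ_eq_add_one, add_comm]
  exact (isHomogeneous_linearPoly _).mul hp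

end PolynomialAlgebra

/-! ### Coordinates on the semidirect product -/

section Semidirect

variable (L V : Type u) [LieRing L] [LieAlgebra ℂ L]
  [AddCommGroup V] [Module ℂ V] [LieRingModule L V] [LieModule ℂ L V]

/-- The `V`-component of an element of `L ⋉ V`. -/
def semidirectVec : SemidirectLie L V →ₗ[ℂ] V where
  toFun a := a.left
  map_add' _ _ := rfl
  map_smul' _ _ := rfl

/-- The `L`-component of an element of `L ⋉ V`. -/
def semidirectLie : SemidirectLie L V →ₗ⁅ℂ⁆ L :=
  LieAlgebra.SemiDirectSum.projr (actionDerivation L V)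

/-- The inclusion of `V` in `L ⋉ V`. -/
def semidirectInl : V →ₗ[ℂ] SemidirectLie L V where
  toFun v := ⟨v, 0⟩
  map_add' v w := by
    rw [LieAlgebra.SemiDirectSum.add_eq_mk, add_zero]
    rfl
  map_smul' c v := by
    rw [LieAlgebra.SemiDirectSum.smul_eq_mk, smul_zero]
    rfl

/-- The inclusion of `L` in `L ⋉ V`. -/
def semidirectInr : L →ₗ⁅ℂ⁆ SemidirectLie L V :=
  LieAlgebra.SemiDirectSum.inr (actionDerivation L V)

variable {L V}

theorem semidirectVec_lie (a b : SemidirectLie L V) :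
    semidirectVec L V ⁅a, b⁆ = ⁅semidirectLie L V a, semidirectVec L V b⁆ -
      ⁅semidirectLie L V b, semidirectVec L V a⁆ := by
  exact congrArg (· - ⁅semidirectLie L V b, semidirectVec L V a⁆)
    (zero_add ⁅semidirectLie L V a, semidirectVec L V b⁆)

@[simp] theorem semidirectVec_inl (v : V) : semidirectVec L V (semidirectInl L V v) = v := rfl

@[simp] theorem semidirectLie_inl (v : V) : semidirectLie L V (semidirectInl L V v) = 0 := rfl

@[simp] theorem semidirectVec_inr (x : L) : semidirectVec L V (semidirectInr L V x) = 0 := rfl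

@[simp] theorem semidirectLie_inr (x : L) : semidirectLie L V (semidirectInr L V x) = x := rfl

theorem semidirect_ext {a b : SemidirectLie L V} (h : semidirectVec L V a = semidirectVec L V b)
    (h' : semidirectLie L V a = semidirectLie L V b) : a = b :=
  LieAlgebra.SemiDirectSum.ext h h'

theorem semidirect_eq_inl_add_inr (a : SemidirectLie L V) :
    a = semidirectInl L V (semidirectVec L V a) + semidirectInr L V (semidirectLie L V a) :=
  semidirect_ext (by rw [map_add]; simp) (by rw [map_add]; simp)

theorem semidirectInl_lie_inl (v w : V) : ⁅semidirectInl L V v, semidirectInl L V w⁆ = 0 :=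
  semidirect_ext (by rw [semidirectVec_lie, map_zero]; simp)
    (by rw [LieHom.map_lie, map_zero]; simp)

theorem semidirectInr_lie_inl (x : L) (v : V) :
    ⁅semidirectInr L V x, semidirectInl L V v⁆ = semidirectInl L V ⁅x, v⁆ :=
  semidirect_ext (by rw [semidirectVec_lie]; simp) (by rw [LieHom.map_lie]; simp)

theorem semidirectInr_mem (x : L) : semidirectInr L V x ∈ semidirectGrading L V 0 :=
  LinearMap.mem_range_self _ x

theorem semidirectInl_mem (v : V) : semidirectInl L V v ∈ semidirectGrading L V 1 :=
  ⟨v, rfl⟩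

end Semidirect

/-! ### The grading of `Sym V ⊗ W` -/

section TensorPieces

variable (V W : Type u) [AddCommGroup V] [Module ℂ V] [AddCommGroup W] [Module ℂ W]

/-- The graded pieces of the tensor product of the symmetric algebra and a vector space. -/
noncomputable def polyTensorPiece (k : ℤ) : Submodule ℂ (PolyAlg V ⊗[ℂ] W) :=
  LinearMap.range ((polyComponent V k).rTensor W)

variable {V W}

theorem tmul_mem_polyTensorPiece {k : ℤ} {p : PolyAlg V} (hp : p ∈ polyHomogeneous V k) (w : W) :
    p ⊗ₜ w ∈ polyTensorPiece V W k :=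
  ⟨p ⊗ₜ w, by rw [LinearMap.rTensor_tmul, polyComponent_of_mem hp, if_pos rfl]⟩

/-- A piece is spanned by the tensors with homogeneous first factor, so linear identities on it can
be checked there. -/
theorem polyTensorPiece_le {k : ℤ} {N : Submodule ℂ (PolyAlg V ⊗[ℂ] W)}
    (h : ∀ p ∈ polyHomogeneous V k, ∀ w : W, p ⊗ₜ w ∈ N) : polyTensorPiece V W k ≤ N := by
  rintro _ ⟨t, rfl⟩
  induction t using TensorProduct.induction_on with
  | zero => rw [map_zero]; exact zero_mem _
  | tmul p w => exact h _ (polyComponent_mem k p) w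
  | add a b ha hb => rw [map_add]; exact add_mem ha hb

end TensorPieces

/-! ### Modules induced from `L` to `L ⋉ V` -/

section InducedModule

variable (L V W : Type u) [LieRing L] [LieAlgebra ℂ L]
  [AddCommGroup V] [Module ℂ V] [LieRingModule L V] [LieModule ℂ L V] [FiniteDimensional ℂ V]
  [AddCommGroup W] [Module ℂ W] [LieRingModule L W] [LieModule ℂ L W]

/-- The action of `L ⋉ V` on the tensor product of the symmetric algebra of `V` and an
`L`-module. -/
noncomputable def polyTensorAction : SemidirectLie L V →ₗ[ℂ] Module.End ℂ (PolyAlg V ⊗[ℂ] W) where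
  toFun a := (LinearMap.mulLeft ℂ (linearPoly (semidirectVec L V a))).rTensor W +
    (polyDeriv (V := V) (semidirectLie L V a)).toLinearMap.rTensor W +
    (LieModule.toEnd ℂ L W (semidirectLie L V a)).lTensor (PolyAlg V)
  map_add' a b := by
    refine TensorProduct.ext' fun p w => ?_
    simp only [LinearMap.add_apply, LinearMap.rTensor_tmul, LinearMap.lTensor_tmul, map_add,
      LinearMap.mulLeft_apply, Derivation.coeFn_coe, polyDeriv_add,
      Derivation.add_apply, add_mul, TensorProduct.add_tmul, TensorProduct.tmul_add]
    abel
  map_smul' c a := by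
    refine TensorProduct.ext' fun p w => ?_
    simp only [LinearMap.add_apply, LinearMap.rTensor_tmul, LinearMap.lTensor_tmul, map_smul,
      LinearMap.mulLeft_apply, Derivation.coeFn_coe, polyDeriv_smul,
      Derivation.smul_apply, smul_mul_assoc, TensorProduct.smul_tmul', TensorProduct.tmul_smul,
      LinearMap.smul_apply, smul_add, RingHom.id_apply]

variable {L V W}

theorem polyTensorAction_tmul (a : SemidirectLie L V) (p : PolyAlg V) (w : W) :
    polyTensorAction L V W a (p ⊗ₜ w) = (linearPoly (semidirectVec L V a) * p) ⊗ₜ[ℂ] w +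
      polyDeriv (V := V) (semidirectLie L V a) p ⊗ₜ[ℂ] w + p ⊗ₜ[ℂ] ⁅semidirectLie L V a, w⁆ := rfl

/-- Multiplications by vectors commute, as `V` is abelian; the derivation of `x` applied to the
linear polynomial of `v` gives that of `⁅x, v⁆`, which is the mixed bracket. -/
theorem polyTensorAction_lie (a b : SemidirectLie L V) (t : PolyAlg V ⊗[ℂ] W) :
    polyTensorAction L V W ⁅a, b⁆ t =
      polyTensorAction L V W a (polyTensorAction L V W b t) -
      polyTensorAction L V W b (polyTensorAction L V W a t) := by
  suffices h : polyTensorAction L V W ⁅a, b⁆ =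
      polyTensorAction L V W a ∘ₗ polyTensorAction L V W b -
      polyTensorAction L V W b ∘ₗ polyTensorAction L V W a from LinearMap.congr_fun h t
  refine TensorProduct.ext' fun p w => ?_
  rw [LinearMap.sub_apply, LinearMap.comp_apply, LinearMap.comp_apply]
  simp only [polyTensorAction_tmul, map_add, semidirectVec_lie, map_sub, LieHom.map_lie,
    ← polyDeriv_linearPoly, polyDeriv_lie, lie_lie, Derivation.commutator_apply,
    Derivation.leibniz, smul_eq_mul, sub_mul, TensorProduct.add_tmul, TensorProduct.sub_tmul,
    TensorProduct.tmul_sub]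
  rw [mul_left_comm (linearPoly (semidirectVec L V a)), mul_comm p, mul_comm p]
  abel

variable (L V W)

/-- The tensor product of the symmetric algebra of `V` and an `L`-module, as an
`L ⋉ V`-module. -/
@[reducible]
noncomputable def polyTensorLieRingModule :
    LieRingModule (SemidirectLie L V) (PolyAlg V ⊗[ℂ] W) where
  bracket a t := polyTensorAction L V W a t
  add_lie a b t := by rw [map_add, LinearMap.add_apply]
  lie_add a t t' := map_add _ t t'
  leibniz_lie a b t := by rw [polyTensorAction_lie, sub_add_cancel]

theorem polyTensorLieModule :
    @LieModule ℂ (SemidirectLie L V) (PolyAlg V ⊗[ℂ] W) _ _ _ _ _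
      (polyTensorLieRingModule L V W) :=
  letI := polyTensorLieRingModule L V W
  { smul_lie := fun c a t => LinearMap.congr_fun (map_smul (polyTensorAction L V W) c a) t
    lie_smul := fun c a t => map_smul (polyTensorAction L V W a) c t }

variable [FiniteDimensional ℂ W]

/-- The module induced from an `L`-module to the graded Lie algebra `L ⋉ V`. -/
noncomputable def inducedRep : GHat L V where
  carrier := PolyAlg V ⊗[ℂ] W
  lieRingModule := polyTensorLieRingModule L V W
  lieModule := polyTensorLieModule L V W
  piece := polyTensorPiece V W
  isInternal := by
    refine GradedRep.isInternal_of_proj _ (fun k => (polyComponent V k).rTensor W)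
      (fun k t => ⟨t, rfl⟩) (fun k t ht => ?_) (fun k l t ht h => ?_) fun t => ?_
    · rw [← sub_eq_zero]
      change t ∈ LinearMap.ker ((polyComponent V k).rTensor W - LinearMap.id)
      refine polyTensorPiece_le (fun p hp w => ?_) ht
      simp [polyComponent_of_mem hp]
    · change t ∈ LinearMap.ker ((polyComponent V k).rTensor W)
      refine polyTensorPiece_le (fun p hp w => ?_) ht
      simp [polyComponent_of_mem hp, h]
    · classical
      suffices h : ∃ S : Finset ℤ, ∀ T : Finset ℤ, S ⊆ T →
          t = ∑ k ∈ T, (polyComponent V k).rTensor W t from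
        h.imp fun S hS => hS S subset_rfl
      induction t using TensorProduct.induction_on with
      | zero => exact ⟨∅, by simp⟩
      | tmul p w =>
        obtain ⟨S, hS⟩ := exists_sum_polyComponent p
        refine ⟨S, fun T hT => ?_⟩
        simp only [LinearMap.rTensor_tmul]
        rw [← TensorProduct.sum_tmul, ← hS T hT]
      | add a b ha hb =>
        obtain ⟨S, hS⟩ := ha
        obtain ⟨S', hS'⟩ := hb
        refine ⟨S ∪ S', fun T hT => ?_⟩
        simp only [map_add, Finset.sum_add_distrib]
        rw [← hS T (Finset.union_subset_left hT), ← hS' T (Finset.union_subset_right hT)]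
  lie_mem := by
    intro n k a t ha ht
    change polyTensorAction L V W a t ∈ _
    refine (polyTensorPiece_le (N := (polyTensorPiece V W (k + n)).comap
      (polyTensorAction L V W a)) fun p hp w => ?_) ht
    rw [Submodule.mem_comap, polyTensorAction_tmul]
    match n, ha with
    | 0, ⟨x, hx⟩ =>
      subst hx
      rw [Nat.cast_zero, add_zero]
      change (linearPoly (semidirectVec L V (semidirectInr L V x)) * p) ⊗ₜ[ℂ] w + _ + _ ∈ _
      rw [semidirectVec_inr, map_zero, zero_mul, TensorProduct.zero_tmul, zero_add]
      exact add_mem (tmul_mem_polyTensorPiece (polyDeriv_mem _ hp) _)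
        (tmul_mem_polyTensorPiece hp _)
    | 1, ⟨v, hv⟩ =>
      subst hv
      refine add_mem (add_mem (tmul_mem_polyTensorPiece (linearPoly_mul_mem _ hp) _) ?_) ?_
      · change polyDeriv (0 : L) p ⊗ₜ[ℂ] w ∈ _
        rw [show (0 : L) = (0 : ℂ) • 0 by simp, polyDeriv_smul, zero_smul, Derivation.zero_apply,
          TensorProduct.zero_tmul]
        exact zero_mem _
      · change p ⊗ₜ[ℂ] ⁅(0 : L), w⁆ ∈ _
        rw [zero_lie, TensorProduct.tmul_zero]
        exact zero_mem _
    | n + 2, ha =>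
      obtain rfl : a = 0 := ha
      rw [← polyTensorAction_tmul, map_zero, LinearMap.zero_apply]
      exact zero_mem _
  finiteDimensional k := by
    let f : LinearMap.range (polyComponent V k) ⊗[ℂ] W →ₗ[ℂ] PolyAlg V ⊗[ℂ] W :=
      (LinearMap.range (polyComponent V k)).subtype.rTensor W
    refine Submodule.finiteDimensional_of_le (S₂ := LinearMap.range f) ?_
    refine polyTensorPiece_le fun p hp w => ⟨⟨p, p, ?_⟩ ⊗ₜ w, rfl⟩
    rw [polyComponent_of_mem hp, if_pos rfl]

end InducedModule

/-! ### The action of `Sym V` on a graded module -/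

section SymmetricAction

variable {L V : Type u} [LieRing L] [LieAlgebra ℂ L]
  [AddCommGroup V] [Module ℂ V] [LieRingModule L V] [LieModule ℂ L V]

instance pieceLieRingModule (M : GHat L V) (r : ℤ) : LieRingModule L (M.piece r) where
  bracket x m := ⟨⁅semidirectInr L V x, (m : M)⁆, by
    simpa using M.lie_mem (semidirectInr_mem x) m.2⟩
  add_lie x y m := Subtype.ext (by
    change ⁅semidirectInr L V (x + y), (m : M)⁆ = _
    rw [map_add, add_lie]
    rfl)
  lie_add x m n := Subtype.ext (lie_add (semidirectInr L V x) (m : M) (n : M))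
  leibniz_lie x y m := Subtype.ext (by
    change _ = ⁅semidirectInr L V ⁅x, y⁆, (m : M)⁆ + _
    rw [LieHom.map_lie]
    exact leibniz_lie (semidirectInr L V x) (semidirectInr L V y) (m : M))

theorem coe_lie_piece (M : GHat L V) {r : ℤ} (x : L) (m : M.piece r) :
    ((⁅x, m⁆ : M.piece r) : M) = ⁅semidirectInr L V x, (m : M)⁆ := rfl

instance pieceLieModule (M : GHat L V) (r : ℤ) : LieModule ℂ L (M.piece r) where
  smul_lie c x m := Subtype.ext (by
    rw [coe_lie_piece, map_smul, smul_lie]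
    rfl)
  lie_smul c x m := Subtype.ext (lie_smul c (semidirectInr L V x) (m : M))

/-- The map between graded pieces induced by a morphism. -/
def pieceMap {M N : GHat L V} (f : M ⟶ N) (r : ℤ) : M.piece r →ₗ⁅ℂ, L⁆ N.piece r where
  toFun m := ⟨GradedRep.lin f m, GradedRep.lin_mem f m.2⟩
  map_add' m n := Subtype.ext (map_add (GradedRep.lin f) (m : M) (n : M))
  map_smul' c m := Subtype.ext (map_smul (GradedRep.lin f) c (m : M))
  map_lie' {_ _} := Subtype.ext (LieModuleHom.map_lie (GradedRep.lin f) _ _)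

/-- The action of `V` on a graded `L ⋉ V`-module. -/
noncomputable def vecEnd (M : GHat L V) : V →ₗ[ℂ] Module.End ℂ M :=
  (LieModule.toEnd ℂ (SemidirectLie L V) M : SemidirectLie L V →ₗ[ℂ] Module.End ℂ M) ∘ₗ
    semidirectInl L V

theorem vecEnd_apply (M : GHat L V) (v : V) (m : M) : vecEnd M v m = ⁅semidirectInl L V v, m⁆ := rfl

theorem vecEnd_mul_comm (M : GHat L V) (v w : V) :
    vecEnd M v * vecEnd M w = vecEnd M w * vecEnd M v := by
  ext m
  simp only [Module.End.mul_apply, vecEnd_apply]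
  rw [leibniz_lie, semidirectInl_lie_inl, zero_lie, zero_add]

theorem lie_inr_vecEnd (M : GHat L V) (x : L) (v : V) (m : M) :
    ⁅semidirectInr L V x, vecEnd M v m⁆ =
      vecEnd M ⁅x, v⁆ m + vecEnd M v ⁅semidirectInr L V x, m⁆ := by
  rw [vecEnd_apply, leibniz_lie, semidirectInr_lie_inl]
  rfl

/-- Polynomials can be evaluated only in a commutative algebra; the subalgebra of endomorphisms
generated by `V` is one. -/
theorem isMulCommutative_adjoin_vecEnd (M : GHat L V) :
    IsMulCommutative (Algebra.adjoin ℂ (Set.range (vecEnd M))) :=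
  Algebra.isMulCommutative_adjoin ℂ fun _ ⟨v, hv⟩ _ ⟨w, hw⟩ => by
    rw [← hv, ← hw, vecEnd_mul_comm]

variable [FiniteDimensional ℂ V]

open scoped IsMulCommutative in
/-- The action of the symmetric algebra of `V` on a graded `L ⋉ V`-module. -/
noncomputable def polyAction (M : GHat L V) : PolyAlg V →ₐ[ℂ] Module.End ℂ M :=
  have := isMulCommutative_adjoin_vecEnd M
  (Algebra.adjoin ℂ (Set.range (vecEnd M))).val.comp
    (MvPolynomial.aeval fun i => ⟨vecEnd M (Module.finBasis ℂ V i),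
      Algebra.subset_adjoin (Set.mem_range_self _)⟩)

theorem polyAction_X (M : GHat L V) (i : Fin (Module.finrank ℂ V)) :
    polyAction M (MvPolynomial.X i) = vecEnd M (Module.finBasis ℂ V i) := by
  simp [polyAction]

theorem polyAction_linearPoly (M : GHat L V) (v : V) :
    polyAction M (linearPoly v) = vecEnd M v := by
  suffices h : (polyAction M).toLinearMap ∘ₗ linearPoly = vecEnd M from LinearMap.congr_fun h v
  refine (Module.finBasis ℂ V).ext fun i => ?_
  simp [polyAction_X]

theorem polyAction_C (M : GHat L V) (c : ℂ) (m : M) :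
    polyAction M (MvPolynomial.C c) m = c • m := by
  rw [← MvPolynomial.algebraMap_eq, AlgHom.commutes, Module.algebraMap_end_apply]

theorem polyAction_mul (M : GHat L V) (p q : PolyAlg V) (m : M) :
    polyAction M (p * q) m = polyAction M p (polyAction M q m) := by
  rw [map_mul, Module.End.mul_apply]

theorem lie_inr_polyAction (M : GHat L V) (x : L) (p : PolyAlg V) (m : M) :
    ⁅semidirectInr L V x, polyAction M p m⁆ =
      polyAction M (polyDeriv x p) m + polyAction M p ⁅semidirectInr L V x, m⁆ := by
  induction p using MvPolynomial.induction_on generalizing m with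
  | C c =>
    rw [MvPolynomial.derivation_C, polyAction_C, polyAction_C, lie_smul, map_zero,
      LinearMap.zero_apply, zero_add]
  | add p q hp hq =>
    simp only [map_add, LinearMap.add_apply, lie_add, hp, hq]
    abel
  | mul_X p i hp =>
    rw [polyAction_mul, hp, Derivation.leibniz, polyDeriv_X, map_add, LinearMap.add_apply,
      smul_eq_mul, smul_eq_mul, mul_comm (MvPolynomial.X i), polyAction_mul, polyAction_mul,
      polyAction_mul, polyAction_linearPoly, polyAction_X, lie_inr_vecEnd, map_add]
    abel

theorem polyAction_mem (M : GHat L V) {k r : ℤ} {p : PolyAlg V} (hp : p ∈ polyHomogeneous V k)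
    {m : M} (hm : m ∈ M.piece r) : polyAction M p m ∈ M.piece (r + k) := by
  refine polyHomogeneous_induction (motive := fun k p => polyAction M p m ∈ M.piece (r + k)) hp
    (by rw [map_zero]; exact zero_mem _) fun n p hp => ?_
  induction n generalizing p with
  | zero =>
    rw [MvPolynomial.totalDegree_eq_zero_iff_eq_C.mp (Nat.le_zero.mp hp.totalDegree_le),
      polyAction_C, Nat.cast_zero, add_zero]
    exact Submodule.smul_mem _ _ hm
  | succ n ih =>
    have hn : ((n + 1 : ℕ) : ℂ) ≠ 0 := Nat.cast_ne_zero.mpr n.succ_ne_zero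
    -- Euler's formula writes `p` as a combination of products of a variable and a polynomial of
    -- smaller degree.
    have h : p = ((n + 1 : ℕ) : ℂ)⁻¹ •
        ∑ i, (MvPolynomial.X i : PolyAlg V) * MvPolynomial.pderiv i p := by
      rw [hp.sum_X_mul_pderiv, ← Nat.cast_smul_eq_nsmul ℂ, smul_smul, inv_mul_cancel₀ hn, one_smul]
    rw [h, map_smul, map_sum, LinearMap.smul_apply, LinearMap.sum_apply]
    refine Submodule.smul_mem _ _ (sum_mem fun i _ => ?_)
    rw [polyAction_mul, polyAction_X, vecEnd_apply, Nat.cast_succ, ← add_assoc]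
    exact M.lie_mem (semidirectInl_mem _) (ih _ hp.pderiv)

theorem lin_polyAction {M N : GHat L V} (f : M ⟶ N) (p : PolyAlg V) (m : M) :
    GradedRep.lin f (polyAction M p m) = polyAction N p (GradedRep.lin f m) := by
  induction p using MvPolynomial.induction_on generalizing m with
  | C c => rw [polyAction_C, polyAction_C, map_smul]
  | add p q hp hq => simp only [map_add, LinearMap.add_apply, hp, hq]
  | mul_X p i hp =>
    rw [polyAction_mul, polyAction_mul, hp, polyAction_X, polyAction_X, vecEnd_apply,
      vecEnd_apply, LieModuleHom.map_lie]

end SymmetricAction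

/-! ### Frobenius reciprocity and projectivity -/

section UniversalProperty

variable {L V W : Type u} [LieRing L] [LieAlgebra ℂ L]
  [AddCommGroup V] [Module ℂ V] [LieRingModule L V] [LieModule ℂ L V] [FiniteDimensional ℂ V]
  [AddCommGroup W] [Module ℂ W] [LieRingModule L W] [LieModule ℂ L W] [FiniteDimensional ℂ W]

variable (L) in
/-- The identification of an induced module with a tensor product. -/
noncomputable def inducedMk (r : ℤ) :
    PolyAlg V ⊗[ℂ] W ≃ₗ[ℂ] (inducedRep L V W).shift r :=
  LinearEquiv.refl ℂ (PolyAlg V ⊗[ℂ] W)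

theorem lie_inducedMk (r : ℤ) (a : SemidirectLie L V) (t : PolyAlg V ⊗[ℂ] W) :
    ⁅a, inducedMk L r t⁆ = inducedMk L r (polyTensorAction L V W a t) := rfl

theorem inducedMk_mem_iff {k r : ℤ} {t : PolyAlg V ⊗[ℂ] W} :
    inducedMk L r t ∈ ((inducedRep L V W).shift r).piece k ↔ t ∈ polyTensorPiece V W (k - r) :=
  Iff.rfl

theorem inducedMk_one_tmul_mem (r : ℤ) (w : W) :
    inducedMk L r ((1 : PolyAlg V) ⊗ₜ w) ∈ ((inducedRep L V W).shift r).piece r := by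
  rw [inducedMk_mem_iff, sub_self]
  exact tmul_mem_polyTensorPiece (mem_polyHomogeneous_natCast (n := 0).mpr
    (MvPolynomial.isHomogeneous_one _ ℂ)) w

theorem vecEnd_inducedMk (r : ℤ) (v : V) (q : PolyAlg V) (w : W) :
    vecEnd ((inducedRep L V W).shift r) v (inducedMk L r (q ⊗ₜ w)) =
      inducedMk L r ((linearPoly v * q) ⊗ₜ w) := by
  rw [vecEnd_apply, lie_inducedMk, polyTensorAction_tmul, semidirectVec_inl, semidirectLie_inl,
    zero_lie, TensorProduct.tmul_zero, add_zero,
    show (polyDeriv (0 : L) q : PolyAlg V) = 0 by simp [polyDeriv_apply],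
    TensorProduct.zero_tmul, add_zero]

theorem polyAction_inducedMk (r : ℤ) (p q : PolyAlg V) (w : W) :
    polyAction ((inducedRep L V W).shift r) p (inducedMk L r (q ⊗ₜ w)) =
      inducedMk L r ((p * q) ⊗ₜ w) := by
  induction p using MvPolynomial.induction_on generalizing q with
  | C c => rw [polyAction_C, MvPolynomial.C_mul', ← map_smul, TensorProduct.smul_tmul']
  | add p p' hp hp' =>
    rw [map_add, LinearMap.add_apply, hp, hp', add_mul, TensorProduct.add_tmul, map_add]
  | mul_X p i hp =>
    rw [polyAction_mul, polyAction_X, vecEnd_inducedMk, hp, linearPoly_finBasis, mul_assoc]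

variable {M : GHat L V} {r : ℤ}

/-- The morphism from an induced module which extends a map of `L`-modules. -/
noncomputable def inducedDesc (φ : W →ₗ⁅ℂ, L⁆ M.piece r) : (inducedRep L V W).shift r ⟶ M :=
  let F : PolyAlg V ⊗[ℂ] W →ₗ[ℂ] M := TensorProduct.lift
    (LinearMap.lcomp ℂ M ((M.piece r).subtype ∘ₗ (φ : W →ₗ[ℂ] M.piece r)) ∘ₗ
      (polyAction M).toLinearMap)
  have hF : ∀ p w, F (p ⊗ₜ w) = polyAction M p (φ w) := fun _ _ => rfl
  GradedRep.homMk
    { F with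
      map_lie' := fun {a t} => by
        suffices h : F ∘ₗ polyTensorAction L V W a =
            (LieModule.toEnd ℂ (SemidirectLie L V) M a : M →ₗ[ℂ] M) ∘ₗ F from
          LinearMap.congr_fun h t
        refine TensorProduct.ext' fun p w => ?_
        rw [LinearMap.comp_apply, LinearMap.comp_apply, polyTensorAction_tmul, map_add, map_add, hF,
          hF, hF, hF, LieModule.toEnd_apply_apply]
        conv_rhs => rw [semidirect_eq_inl_add_inr a]
        rw [add_lie, lie_inr_polyAction, ← vecEnd_apply, polyAction_mul, polyAction_linearPoly,
          LieModuleHom.map_lie, coe_lie_piece, add_assoc] }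
    fun {k t} ht => by
      refine polyTensorPiece_le (N := (M.piece k).comap F) (fun p hp w => ?_) ht
      rw [Submodule.mem_comap, hF, show k = r + (k - r) by ring]
      exact polyAction_mem M hp (φ w).2

theorem lin_inducedDesc (φ : W →ₗ⁅ℂ, L⁆ M.piece r) (p : PolyAlg V) (w : W) :
    GradedRep.lin (inducedDesc φ) (inducedMk L r (p ⊗ₜ w)) = polyAction M p (φ w) := rfl

theorem lin_inducedDesc_one (φ : W →ₗ⁅ℂ, L⁆ M.piece r) (w : W) :
    GradedRep.lin (inducedDesc φ) (inducedMk L r ((1 : PolyAlg V) ⊗ₜ w)) = φ w := by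
  rw [lin_inducedDesc, map_one, Module.End.one_apply]

theorem inducedRep_linearMap_ext {N : Type*} [AddCommGroup N] [Module ℂ N]
    {f g : (inducedRep L V W).shift r →ₗ[ℂ] N}
    (h : ∀ p w, f (inducedMk L r (p ⊗ₜ w)) = g (inducedMk L r (p ⊗ₜ w))) : f = g := by
  have : f ∘ₗ (inducedMk L r).toLinearMap = g ∘ₗ (inducedMk L r).toLinearMap :=
    TensorProduct.ext' h
  refine LinearMap.ext fun t => ?_
  obtain ⟨t, rfl⟩ := (inducedMk L r).surjective t
  exact LinearMap.congr_fun this t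

/-- The vectors `1 ⊗ w` generate under `Sym V`, and morphisms commute with `Sym V`. -/
theorem inducedRep_hom_ext {f g : (inducedRep L V W).shift r ⟶ M}
    (h : ∀ w : W, GradedRep.lin f (inducedMk L r ((1 : PolyAlg V) ⊗ₜ w)) =
      GradedRep.lin g (inducedMk L r ((1 : PolyAlg V) ⊗ₜ w))) : f = g := by
  have h' : (GradedRep.lin f : (inducedRep L V W).shift r →ₗ[ℂ] M) =
      (GradedRep.lin g : (inducedRep L V W).shift r →ₗ[ℂ] M) := by
    refine inducedRep_linearMap_ext fun p w => ?_
    rw [← mul_one p, ← polyAction_inducedMk]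
    exact (lin_polyAction f p _).trans ((congrArg (polyAction M p) (h w)).trans
      (lin_polyAction g p _).symm)
  exact GradedRep.hom_ext fun t => LinearMap.congr_fun h' t

/-- The inclusion of an `L`-module in its induced module. -/
noncomputable def inducedUnit (r : ℤ) :
    W →ₗ⁅ℂ, L⁆ ((inducedRep L V W).shift r).piece r where
  toFun w := ⟨inducedMk L r ((1 : PolyAlg V) ⊗ₜ w), inducedMk_one_tmul_mem r w⟩
  map_add' w w' := Subtype.ext
    (congrArg (inducedMk L r) (TensorProduct.tmul_add (1 : PolyAlg V) w w'))
  map_smul' c w := Subtype.ext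
    (congrArg (inducedMk L r) (TensorProduct.tmul_smul c (1 : PolyAlg V) w))
  map_lie' {x w} := Subtype.ext (by
    rw [coe_lie_piece, lie_inducedMk, polyTensorAction_tmul, semidirectVec_inr, map_zero, zero_mul,
      Derivation.map_one_eq_zero, TensorProduct.zero_tmul, zero_add, zero_add, semidirectLie_inr])

variable (M r W) in
/-- Frobenius reciprocity for induced modules. -/
noncomputable def inducedHomEquiv :
    ((inducedRep L V W).shift r ⟶ M) ≃ₗ[ℂ] (W →ₗ⁅ℂ, L⁆ M.piece r) where
  toFun f := (pieceMap f r).comp (inducedUnit r)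
  map_add' _ _ := rfl
  map_smul' _ _ := rfl
  invFun := inducedDesc
  left_inv _ := inducedRep_hom_ext fun w => lin_inducedDesc_one _ w
  right_inv φ := LieModuleHom.ext fun w => Subtype.ext (lin_inducedDesc_one φ w)

/-- By Frobenius reciprocity the lifting problem lives in degree `r`. There an epimorphism is a
surjection of finite-dimensional `L`-modules, and complete reducibility applies. -/
instance projective_inducedRep [FiniteDimensional ℂ L] [LieAlgebra.IsSemisimple ℂ L] (r : ℤ) :
    Projective ((inducedRep L V W).shift r) where
  factors {E X} f e _ := by
    have he : Function.Surjective (pieceMap e r) := fun ⟨x, hx⟩ => by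
      obtain ⟨y, hy, rfl⟩ :=
        GradedRep.exists_mem_of_surjective e (GradedRep.surjective_of_epi e) hx
      exact ⟨⟨y, hy⟩, rfl⟩
    obtain ⟨h, hh⟩ := exists_lieModuleHom_comp_eq (pieceMap e r) he (inducedHomEquiv W X r f)
    refine ⟨inducedDesc h, (inducedHomEquiv W X r).injective ?_⟩
    rw [← hh]
    refine LieModuleHom.ext fun w => Subtype.ext ?_
    exact congrArg (GradedRep.lin e) (lin_inducedDesc_one h w)

end UniversalProperty

/-! ### The Koszul differential and its homotopy -/

section KoszulLinear

variable (V S : Type u) [AddCommGroup V] [Module ℂ V] [FiniteDimensional ℂ V]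
  [AddCommGroup S] [Module ℂ S]

/-- The underlying linear map of the Koszul differential. -/
noncomputable def koszulLinear (n : ℕ) :
    PolyAlg V ⊗[ℂ] (⋀[ℂ]^(n + 1) V ⊗[ℂ] S) →ₗ[ℂ] PolyAlg V ⊗[ℂ] (⋀[ℂ]^n V ⊗[ℂ] S) :=
  ∑ i, TensorProduct.map (LinearMap.mulLeft ℂ (MvPolynomial.X i))
    ((exteriorPower.contract n ((Module.finBasis ℂ V).coord i)).rTensor S)

/-- The contracting homotopy of the Koszul complex, up to a scalar in each degree. -/
noncomputable def koszulHomotopy (n : ℕ) :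
    PolyAlg V ⊗[ℂ] (⋀[ℂ]^n V ⊗[ℂ] S) →ₗ[ℂ] PolyAlg V ⊗[ℂ] (⋀[ℂ]^(n + 1) V ⊗[ℂ] S) :=
  ∑ i, TensorProduct.map (MvPolynomial.pderiv i).toLinearMap
    ((exteriorPower.wedge n (Module.finBasis ℂ V i)).rTensor S)

variable {V S}

theorem koszulLinear_tmul (n : ℕ) (p : PolyAlg V) (w : ⋀[ℂ]^(n + 1) V ⊗[ℂ] S) :
    koszulLinear V S n (p ⊗ₜ w) = ∑ i, (MvPolynomial.X i * p) ⊗ₜ[ℂ]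
      (exteriorPower.contract n ((Module.finBasis ℂ V).coord i)).rTensor S w := by
  rw [koszulLinear, LinearMap.sum_apply]
  rfl

theorem koszulHomotopy_tmul (n : ℕ) (p : PolyAlg V) (w : ⋀[ℂ]^n V ⊗[ℂ] S) :
    koszulHomotopy V S n (p ⊗ₜ w) = ∑ i, MvPolynomial.pderiv i p ⊗ₜ[ℂ]
      (exteriorPower.wedge n (Module.finBasis ℂ V i)).rTensor S w := by
  rw [koszulHomotopy, LinearMap.sum_apply]
  rfl

/-- Variables commute and contractions anticommute, so the double sum equals its own negative. -/
theorem koszulLinear_koszulLinear (n : ℕ) (t : PolyAlg V ⊗[ℂ] (⋀[ℂ]^(n + 1 + 1) V ⊗[ℂ] S)) :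
    koszulLinear V S n (koszulLinear V S (n + 1) t) = 0 := by
  suffices h : koszulLinear V S n ∘ₗ koszulLinear V S (n + 1) = 0 from LinearMap.congr_fun h t
  refine TensorProduct.ext' fun p w => ?_
  induction w using TensorProduct.induction_on with
  | zero => simp
  | add w w' h h' => rw [TensorProduct.tmul_add, map_add, map_add, h, h']
  | tmul y s =>
    simp only [LinearMap.comp_apply, LinearMap.zero_apply, koszulLinear_tmul, map_sum,
      LinearMap.rTensor_tmul]
    set X := ∑ i, ∑ j, ((MvPolynomial.X j : PolyAlg V) * (MvPolynomial.X i * p)) ⊗ₜ[ℂ]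
      (exteriorPower.contract n ((Module.finBasis ℂ V).coord j)
        (exteriorPower.contract (n + 1) ((Module.finBasis ℂ V).coord i) y) ⊗ₜ[ℂ] s) with hX
    have h : X = -X := by
      rw [hX]
      conv_rhs => rw [Finset.sum_comm]
      simp only [← Finset.sum_neg_distrib]
      refine Finset.sum_congr rfl fun i _ => Finset.sum_congr rfl fun j _ => ?_
      rw [eq_neg_iff_add_eq_zero, exteriorPower.contract_contract, mul_left_comm,
        ← TensorProduct.tmul_add, ← TensorProduct.add_tmul, neg_add_cancel,
        TensorProduct.zero_tmul, TensorProduct.tmul_zero]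
    have h2 : (2 : ℂ) • X = 0 := by
      rw [two_smul]
      nth_rewrite 1 [h]
      exact neg_add_cancel X
    exact (smul_eq_zero.mp h2).resolve_left two_ne_zero

omit [FiniteDimensional ℂ V] in
theorem sum_X_mul_pderiv_of_mem {k : ℤ} {p : PolyAlg V} (hp : p ∈ polyHomogeneous V k) :
    ∑ i, (MvPolynomial.X i : PolyAlg V) * MvPolynomial.pderiv i p = (k : ℂ) • p := by
  refine polyHomogeneous_induction (motive := fun k p =>
    ∑ i, (MvPolynomial.X i : PolyAlg V) * MvPolynomial.pderiv i p = (k : ℂ) • p) hp (by simp)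
    fun n p hp => ?_
  rw [hp.sum_X_mul_pderiv, Int.cast_natCast, Nat.cast_smul_eq_nsmul]

/-- In exterior degree zero only one composite exists, and it is the Euler operator `∑ Xᵢ ∂ᵢ`. -/
theorem koszulLinear_koszulHomotopy_zero {k : ℤ} {t : PolyAlg V ⊗[ℂ] (⋀[ℂ]^0 V ⊗[ℂ] S)}
    (ht : t ∈ polyTensorPiece V (⋀[ℂ]^0 V ⊗[ℂ] S) k) :
    koszulLinear V S 0 (koszulHomotopy V S 0 t) = (k : ℂ) • t := by
  classical
  rw [← sub_eq_zero]
  change t ∈ LinearMap.ker (koszulLinear V S 0 ∘ₗ koszulHomotopy V S 0 - (k : ℂ) • LinearMap.id)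
  refine polyTensorPiece_le (fun p hp w => ?_) ht
  rw [LinearMap.mem_ker]
  induction w using TensorProduct.induction_on with
  | zero => simp
  | add w w' h h' => rw [TensorProduct.tmul_add, map_add, h, h', add_zero]
  | tmul y s =>
    simp only [LinearMap.comp_apply, LinearMap.sub_apply, LinearMap.smul_apply,
      LinearMap.id_apply, koszulLinear_tmul, koszulHomotopy_tmul, map_sum,
      LinearMap.rTensor_tmul, exteriorPower.contract_wedge_zero, Module.Basis.coord_apply,
      Module.Basis.repr_self, Finsupp.single_apply, ite_smul, one_smul, zero_smul,
      TensorProduct.ite_tmul, TensorProduct.tmul_ite, Finset.sum_ite_eq, Finset.mem_univ, if_true]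
    rw [← TensorProduct.sum_tmul, sum_X_mul_pderiv_of_mem hp, TensorProduct.smul_tmul', sub_self]

/-- The terms `Xⱼ ∂ᵢ p ⊗ bᵢ ∧ ι(bⱼ*) y` occur in the two composites with opposite signs. What
survives is `∑ Xᵢ ∂ᵢ = k` from the first, by the Leibniz rule for contraction, and `∑ bᵢ ∧ ι(bᵢ*) =
n + 1` from the second, by the Leibniz rule for `∂ᵢ`. -/
theorem koszul_homotopy_identity (n : ℕ) {k : ℤ} {t : PolyAlg V ⊗[ℂ] (⋀[ℂ]^(n + 1) V ⊗[ℂ] S)}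
    (ht : t ∈ polyTensorPiece V (⋀[ℂ]^(n + 1) V ⊗[ℂ] S) k) :
    koszulLinear V S (n + 1) (koszulHomotopy V S (n + 1) t) +
      koszulHomotopy V S n (koszulLinear V S n t) = ((k : ℂ) + ((n : ℂ) + 1)) • t := by
  classical
  rw [← sub_eq_zero]
  change t ∈ LinearMap.ker (koszulLinear V S (n + 1) ∘ₗ koszulHomotopy V S (n + 1) +
    koszulHomotopy V S n ∘ₗ koszulLinear V S n - ((k : ℂ) + ((n : ℂ) + 1)) • LinearMap.id)
  refine polyTensorPiece_le (fun p hp w => ?_) ht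
  rw [LinearMap.mem_ker]
  induction w using TensorProduct.induction_on with
  | zero => simp
  | add w w' h h' => rw [TensorProduct.tmul_add, map_add, h, h', add_zero]
  | tmul y s =>
    have h1 : koszulLinear V S (n + 1) (koszulHomotopy V S (n + 1) (p ⊗ₜ (y ⊗ₜ s))) =
        (k : ℂ) • (p ⊗ₜ (y ⊗ₜ s)) - ∑ i, ∑ j,
          (MvPolynomial.X j * MvPolynomial.pderiv i p) ⊗ₜ[ℂ]
            (exteriorPower.wedge n (Module.finBasis ℂ V i)
              (exteriorPower.contract n ((Module.finBasis ℂ V).coord j) y) ⊗ₜ[ℂ] s) := by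
      rw [TensorProduct.smul_tmul', ← sum_X_mul_pderiv_of_mem hp, TensorProduct.sum_tmul,
        ← Finset.sum_sub_distrib, koszulHomotopy_tmul, map_sum]
      refine Finset.sum_congr rfl fun i _ => ?_
      rw [koszulLinear_tmul, eq_sub_iff_add_eq, ← Finset.sum_add_distrib,
        Finset.sum_eq_single_of_mem i (Finset.mem_univ i)]
      · rw [LinearMap.rTensor_tmul, LinearMap.rTensor_tmul, exteriorPower.contract_wedge,
          ← TensorProduct.tmul_add, ← TensorProduct.add_tmul, sub_add_cancel,
          Module.Basis.coord_apply, Module.Basis.repr_self, Finsupp.single_eq_same, one_smul]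
      · intro j _ hj
        rw [LinearMap.rTensor_tmul, LinearMap.rTensor_tmul, exteriorPower.contract_wedge,
          ← TensorProduct.tmul_add, ← TensorProduct.add_tmul, sub_add_cancel,
          Module.Basis.coord_apply, Module.Basis.repr_self, Finsupp.single_eq_of_ne hj, zero_smul,
          TensorProduct.zero_tmul, TensorProduct.tmul_zero]
    have h2 : koszulHomotopy V S n (koszulLinear V S n (p ⊗ₜ (y ⊗ₜ s))) =
        ((n : ℂ) + 1) • (p ⊗ₜ (y ⊗ₜ s)) + ∑ i, ∑ j,
          (MvPolynomial.X j * MvPolynomial.pderiv i p) ⊗ₜ[ℂ]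
            (exteriorPower.wedge n (Module.finBasis ℂ V i)
              (exteriorPower.contract n ((Module.finBasis ℂ V).coord j) y) ⊗ₜ[ℂ] s) := by
      rw [← TensorProduct.tmul_smul, TensorProduct.smul_tmul',
        ← exteriorPower.sum_wedge_contract (Module.finBasis ℂ V), TensorProduct.sum_tmul,
        TensorProduct.tmul_sum, Finset.sum_comm, ← Finset.sum_add_distrib, koszulLinear_tmul,
        map_sum]
      refine Finset.sum_congr rfl fun j _ => ?_
      rw [koszulHomotopy_tmul, ← sub_eq_iff_eq_add, ← Finset.sum_sub_distrib,
        Finset.sum_eq_single_of_mem j (Finset.mem_univ j)]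
      · rw [LinearMap.rTensor_tmul, LinearMap.rTensor_tmul, ← TensorProduct.sub_tmul,
          Derivation.leibniz, MvPolynomial.pderiv_X_self, smul_eq_mul, smul_eq_mul, mul_one,
          add_sub_cancel_left]
      · intro i _ hi
        rw [LinearMap.rTensor_tmul, LinearMap.rTensor_tmul, ← TensorProduct.sub_tmul,
          Derivation.leibniz, MvPolynomial.pderiv_X_of_ne hi.symm, smul_eq_mul, smul_eq_mul,
          mul_zero, add_zero, sub_self, TensorProduct.zero_tmul]
    rw [LinearMap.sub_apply, LinearMap.add_apply, LinearMap.comp_apply, LinearMap.comp_apply, h1,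
      h2, LinearMap.smul_apply, LinearMap.id_apply, add_smul (k : ℂ)]
    abel

theorem koszulLinear_mem (n : ℕ) {k l : ℤ} (hl : l = k + 1)
    {t : PolyAlg V ⊗[ℂ] (⋀[ℂ]^(n + 1) V ⊗[ℂ] S)}
    (ht : t ∈ polyTensorPiece V (⋀[ℂ]^(n + 1) V ⊗[ℂ] S) k) :
    koszulLinear V S n t ∈ polyTensorPiece V (⋀[ℂ]^n V ⊗[ℂ] S) l := by
  refine (polyTensorPiece_le (N := (polyTensorPiece V (⋀[ℂ]^n V ⊗[ℂ] S) l).comap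
    (koszulLinear V S n)) fun p hp w => ?_) ht
  rw [Submodule.mem_comap, koszulLinear_tmul, hl]
  refine sum_mem fun i _ => tmul_mem_polyTensorPiece ?_ _
  rw [← linearPoly_finBasis]
  exact linearPoly_mul_mem _ hp

omit [FiniteDimensional ℂ V] in
theorem eq_zero_of_mem_polyTensorPiece_of_neg {W : Type u} [AddCommGroup W] [Module ℂ W] {k : ℤ}
    (hk : k < 0) {t : PolyAlg V ⊗[ℂ] W} (ht : t ∈ polyTensorPiece V W k) : t = 0 := by
  obtain ⟨n, rfl⟩ := Int.eq_negSucc_of_lt_zero hk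
  obtain ⟨t, rfl⟩ := ht
  change (0 : PolyAlg V →ₗ[ℂ] PolyAlg V).rTensor W t = 0
  rw [LinearMap.rTensor_zero, LinearMap.zero_apply]

omit [FiniteDimensional ℂ V] in
theorem exists_eq_one_tmul_of_mem {W : Type u} [AddCommGroup W] [Module ℂ W]
    {t : PolyAlg V ⊗[ℂ] W} (ht : t ∈ polyTensorPiece V W 0) :
    ∃ w, t = (1 : PolyAlg V) ⊗ₜ w := by
  suffices h : t ∈ LinearMap.range (TensorProduct.mk ℂ (PolyAlg V) W 1) from
    h.imp fun w hw => hw.symm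
  refine polyTensorPiece_le (fun p hp w => ?_) ht
  have hp' : p.IsHomogeneous 0 := hp
  rw [MvPolynomial.totalDegree_eq_zero_iff_eq_C.mp (Nat.le_zero.mp hp'.totalDegree_le)]
  refine ⟨MvPolynomial.coeff 0 p • w, ?_⟩
  rw [TensorProduct.mk_apply, ← TensorProduct.smul_tmul, MvPolynomial.smul_eq_C_mul, mul_one]

variable {L : Type u} [LieRing L] [LieAlgebra ℂ L] [LieRingModule L V] [LieModule ℂ L V]
  [LieRingModule L S] [LieModule ℂ L S]

/-- The differential is the action of the canonical element `∑ bᵢ ⊗ bᵢ*` of `V ⊗ V*`, which is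
`L`-invariant; it commutes with `V` because variables commute. -/
theorem koszulLinear_action (n : ℕ) (a : SemidirectLie L V)
    (t : PolyAlg V ⊗[ℂ] (⋀[ℂ]^(n + 1) V ⊗[ℂ] S)) :
    koszulLinear V S n (polyTensorAction L V (⋀[ℂ]^(n + 1) V ⊗[ℂ] S) a t) =
      polyTensorAction L V (⋀[ℂ]^n V ⊗[ℂ] S) a (koszulLinear V S n t) := by
  suffices h : koszulLinear V S n ∘ₗ polyTensorAction L V (⋀[ℂ]^(n + 1) V ⊗[ℂ] S) a =
      polyTensorAction L V (⋀[ℂ]^n V ⊗[ℂ] S) a ∘ₗ koszulLinear V S n from LinearMap.congr_fun h t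
  refine TensorProduct.ext' fun p w => ?_
  induction w using TensorProduct.induction_on with
  | zero => simp
  | add w w' h h' => rw [TensorProduct.tmul_add, map_add, map_add, h, h']
  | tmul y s =>
    set x := semidirectLie L V a with hx
    set b := Module.finBasis ℂ V with hb
    have hcoord : ∀ i, b.coord i ∘ₗ LieModule.toEnd ℂ L V x =
        ∑ k, b.repr ⁅x, b k⁆ i • b.coord k := fun i => b.ext fun k => by
      simp [Finsupp.single_apply]
    have hlie : ∀ i, exteriorPower.contract n (b.coord i) ⁅x, y⁆ =
        ⁅x, exteriorPower.contract n (b.coord i) y⁆ +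
          exteriorPower.contract n (b.coord i ∘ₗ LieModule.toEnd ℂ L V x) y := fun i => by
      rw [exteriorPower.lie_contract, sub_add_cancel]
    -- Invariance of the canonical element: both sides expand into the same matrix coefficients of
    -- `x`, with the two summations interchanged.
    have key : ∑ i, (linearPoly ⁅x, b i⁆ * p) ⊗ₜ[ℂ]
          (exteriorPower.contract n (b.coord i) y ⊗ₜ[ℂ] s) =
        ∑ i, (MvPolynomial.X i * p) ⊗ₜ[ℂ]
          (exteriorPower.contract n (b.coord i ∘ₗ LieModule.toEnd ℂ L V x) y ⊗ₜ[ℂ] s) := by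
      have h1 : ∀ f : Module.Dual ℂ V, exteriorPower.contract n f =
        exteriorPower.contractₗ n f := fun _ => rfl
      simp only [hcoord, h1, linearPoly_apply, map_sum, map_smul, LinearMap.sum_apply,
        LinearMap.smul_apply, Finset.sum_mul, TensorProduct.sum_tmul, TensorProduct.tmul_sum,
        smul_mul_assoc, TensorProduct.tmul_smul, ← TensorProduct.smul_tmul', ← hb]
      rw [Finset.sum_comm]
    simp only [LinearMap.comp_apply, polyTensorAction_tmul, koszulLinear_tmul, map_add, map_sum,
      LinearMap.rTensor_tmul, TensorProduct.LieModule.lie_tmul_right, ← hx, ← hb,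
      hlie, Derivation.leibniz, polyDeriv_X, smul_eq_mul, TensorProduct.add_tmul,
      TensorProduct.tmul_add, Finset.sum_add_distrib]
    simp only [mul_comm p, key, mul_left_comm (linearPoly (semidirectVec L V a))]
    abel

end KoszulLinear

/-! ### Exactness and epimorphisms tested on elements -/

namespace GradedRep

variable {A : Type u} [LieRing A] [LieAlgebra ℂ A] {𝒜 : ℕ → Submodule ℂ A}

open Limits in
/-- Exactness can be checked on homogeneous elements. -/
theorem exact_of_forall_piece {X Y Z : GradedRep 𝒜} (f : X ⟶ Y) (g : Y ⟶ Z) (w : f ≫ g = 0)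
    (h : ∀ k, ∀ y ∈ Y.piece k, lin g y = 0 → ∃ x, lin f x = y) :
    (ShortComplex.mk f g w).Exact := by
  rw [ShortComplex.exact_iff_kernel_ι_comp_cokernel_π_zero]
  refine hom_ext fun x => ?_
  have hx : lin g (lin (kernel.ι g) x) = 0 := by rw [← lin_comp, kernel.condition, lin_zero]
  obtain ⟨S, hS⟩ := Y.exists_sum_proj (lin (kernel.ι g) x)
  change lin (cokernel.π f) (lin (kernel.ι g) x) = 0
  rw [hS, map_sum]
  refine Finset.sum_eq_zero fun k _ => ?_
  obtain ⟨z, hz⟩ := h k _ (Y.proj_mem k _) (by rw [lin_proj, hx, map_zero])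
  rw [← hz, ← lin_comp, cokernel.condition, lin_zero]

theorem epi_of_surjective {X Y : GradedRep 𝒜} (f : X ⟶ Y) (hf : Function.Surjective (lin f)) :
    Epi f where
  left_cancellation g h w := hom_ext fun y => by
    obtain ⟨x, rfl⟩ := hf y
    rw [← lin_comp, ← lin_comp, w]

end GradedRep

/-! ### The Koszul resolution and the computation of `Ext` -/

section KoszulComplex

variable {L V S W : Type u} [LieRing L] [LieAlgebra ℂ L]
  [AddCommGroup V] [Module ℂ V] [LieRingModule L V] [LieModule ℂ L V]
  [AddCommGroup S] [Module ℂ S] [LieRingModule L S] [LieModule ℂ L S] [FiniteDimensional ℂ S]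
  [AddCommGroup W] [Module ℂ W] [LieRingModule L W] [LieModule ℂ L W]

theorem mem_piece_evShift {k r : ℤ} (h : k = r) (x : evShift L V S r) :
    x ∈ (evShift L V S r).piece k := by
  change x ∈ if k - r = 0 then ⊤ else ⊥
  rw [if_pos (by omega)]
  trivial

theorem eq_zero_of_mem_piece_evShift {k r : ℤ} (h : k ≠ r) {x : evShift L V S r}
    (hx : x ∈ (evShift L V S r).piece k) : x = 0 := by
  change x ∈ if k - r = 0 then ⊤ else ⊥ at hx
  rwa [if_neg (by omega)] at hx

theorem vecEnd_evShift (r : ℤ) (v : V) (x : evShift L V S r) :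
    vecEnd (evShift L V S r) v x = 0 :=
  zero_lie (L := L) (M := S) x

variable (L V S) in
/-- The identification of `S` with the concentrated graded module. -/
noncomputable def evShiftMk (r : ℤ) : S ≃ₗ[ℂ] evShift L V S r := LinearEquiv.refl ℂ S

theorem lie_evShiftMk (r : ℤ) (x : L) (s : S) :
    ⁅semidirectInr L V x, evShiftMk L V S r s⁆ = evShiftMk L V S r ⁅x, s⁆ := rfl

variable (V) in
/-- A map to an `L`-module, as a map to the nonzero graded piece of a concentrated graded
module. -/
noncomputable def evShiftLift {k r : ℤ} (h : k = r) (f : W →ₗ⁅ℂ, L⁆ S) :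
    W →ₗ⁅ℂ, L⁆ (evShift L V S r).piece k where
  toFun w := ⟨evShiftMk L V S r (f w), mem_piece_evShift h _⟩
  map_add' w w' := Subtype.ext (by rw [map_add, map_add]; rfl)
  map_smul' c w := Subtype.ext (by rw [map_smul, map_smul]; rfl)
  map_lie' {x w} := Subtype.ext (by rw [LieModuleHom.map_lie, coe_lie_piece, lie_evShiftMk])

variable (V W S) in
/-- Maps to the nonzero graded piece of a concentrated graded module. -/
noncomputable def evShiftHomEquiv {k r : ℤ} (h : k = r) :
    (W →ₗ⁅ℂ, L⁆ (evShift L V S r).piece k) ≃ₗ[ℂ] (W →ₗ⁅ℂ, L⁆ S) where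
  toFun f :=
    { toFun w := (evShiftMk L V S r).symm (f w)
      map_add' w w' := by rw [map_add]; rfl
      map_smul' c w := by rw [map_smul]; rfl
      map_lie' {x w} := by rw [LieModuleHom.map_lie]; rfl }
  map_add' _ _ := rfl
  map_smul' _ _ := rfl
  invFun f := evShiftLift V h f
  left_inv _ := rfl
  right_inv _ := rfl

omit [LieModule ℂ L W] in
theorem subsingleton_hom_piece_evShift {k r : ℤ} (h : k ≠ r) :
    Subsingleton (W →ₗ⁅ℂ, L⁆ (evShift L V S r).piece k) where
  allEq f g := LieModuleHom.ext fun w => Subtype.ext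
    ((eq_zero_of_mem_piece_evShift h (f w).2).trans (eq_zero_of_mem_piece_evShift h (g w).2).symm)

variable (L V S) in
/-- The identification of `⋀⁰ V ⊗ S` with `S`. -/
noncomputable def exteriorZeroTensor : ⋀[ℂ]^0 V ⊗[ℂ] S →ₗ⁅ℂ, L⁆ S where
  __ := (TensorProduct.lid ℂ S).toLinearMap ∘ₗ
    (exteriorPower.zeroEquiv ℂ V).toLinearMap.rTensor S
  map_lie' {x w} := by
    have h0 : (LieModule.toEnd ℂ L (⋀[ℂ]^0 V) x : ⋀[ℂ]^0 V →ₗ[ℂ] ⋀[ℂ]^0 V) = 0 := by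
      refine exteriorPower.linearMap_ext ?_
      ext v
      simp [exteriorPower.lie_ιMulti]
    suffices h : ((TensorProduct.lid ℂ S).toLinearMap ∘ₗ
        (exteriorPower.zeroEquiv ℂ V).toLinearMap.rTensor S) ∘ₗ
          (LieModule.toEnd ℂ L (⋀[ℂ]^0 V ⊗[ℂ] S) x : ⋀[ℂ]^0 V ⊗[ℂ] S →ₗ[ℂ] _) =
        (LieModule.toEnd ℂ L S x : S →ₗ[ℂ] S) ∘ₗ (TensorProduct.lid ℂ S).toLinearMap ∘ₗ
          (exteriorPower.zeroEquiv ℂ V).toLinearMap.rTensor S from LinearMap.congr_fun h w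
    refine TensorProduct.ext' fun y s => ?_
    have hy : ⁅x, y⁆ = 0 := LinearMap.congr_fun h0 y
    simp [TensorProduct.LieModule.lie_tmul_right, hy]

omit [FiniteDimensional ℂ S] in
theorem exteriorZeroTensor_bijective : Function.Bijective (exteriorZeroTensor L V S) :=
  ((TensorProduct.congr (exteriorPower.zeroEquiv ℂ V) (LinearEquiv.refl ℂ S)).trans
    (TensorProduct.lid ℂ S)).bijective

variable [FiniteDimensional ℂ V]

variable (L V S) in
/-- The augmentation of the Koszul complex. -/
noncomputable def koszulAug {k r : ℤ} (h : k = r) :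
    (inducedRep L V (⋀[ℂ]^0 V ⊗[ℂ] S)).shift k ⟶ evShift L V S r :=
  inducedDesc (evShiftLift V h (exteriorZeroTensor L V S))

theorem lin_koszulAug_one {k r : ℤ} (h : k = r) (w : ⋀[ℂ]^0 V ⊗[ℂ] S) :
    GradedRep.lin (koszulAug L V S h) (inducedMk L k ((1 : PolyAlg V) ⊗ₜ w)) =
      evShiftMk L V S r (exteriorZeroTensor L V S w) :=
  lin_inducedDesc_one _ w

variable (L V S) in
/-- The Koszul differential. -/
noncomputable def koszulMap (n : ℕ) {k l : ℤ} (h : k = l + 1) :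
    (inducedRep L V (⋀[ℂ]^(n + 1) V ⊗[ℂ] S)).shift k ⟶
      (inducedRep L V (⋀[ℂ]^n V ⊗[ℂ] S)).shift l :=
  GradedRep.homMk
    { (inducedMk L l).toLinearMap ∘ₗ koszulLinear V S n ∘ₗ (inducedMk L k).symm.toLinearMap with
      map_lie' := fun {a t} => by
        obtain ⟨t, rfl⟩ := (inducedMk L k).surjective t
        change inducedMk (W := ⋀[ℂ]^n V ⊗[ℂ] S) L l (koszulLinear V S n
            (polyTensorAction L V (⋀[ℂ]^(n + 1) V ⊗[ℂ] S) a t)) =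
          ⁅a, inducedMk (W := ⋀[ℂ]^n V ⊗[ℂ] S) L l (koszulLinear V S n t)⁆
        rw [koszulLinear_action, lie_inducedMk] }
    fun {i t} ht => koszulLinear_mem n (k := i - k) (l := i - l) (by omega) ht

theorem lin_koszulMap (n : ℕ) {k l : ℤ} (h : k = l + 1)
    (t : PolyAlg V ⊗[ℂ] (⋀[ℂ]^(n + 1) V ⊗[ℂ] S)) :
    GradedRep.lin (koszulMap L V S n h) (inducedMk L k t) = inducedMk L l (koszulLinear V S n t) :=
  rfl

theorem koszulMap_comp_koszulMap (n : ℕ) {k l m : ℤ} (h : k = l + 1) (h' : l = m + 1) :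
    koszulMap L V S (n + 1) h ≫ koszulMap L V S n h' = 0 :=
  GradedRep.hom_ext fun t => koszulLinear_koszulLinear n t

/-- The Koszul differential vanishes after composition with a morphism to a module on which `V`
acts by zero. -/
theorem koszulMap_comp_eq_zero (n : ℕ) {k l : ℤ} (h : k = l + 1) {M : GHat L V}
    (hM : ∀ v m, vecEnd M v m = 0)
    (f : (inducedRep L V (⋀[ℂ]^n V ⊗[ℂ] S)).shift l ⟶ M) : koszulMap L V S n h ≫ f = 0 := by
  refine inducedRep_hom_ext fun w => ?_
  rw [GradedRep.lin_comp, lin_koszulMap, koszulLinear_tmul, map_sum, map_sum, GradedRep.lin_zero]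
  refine Finset.sum_eq_zero fun i _ => ?_
  -- Each term of the differential of `1 ⊗ w` is a basis vector of `V` acting on a generator, so its
  -- image lies in `V` times `M`, which is zero.
  rw [← linearPoly_finBasis, ← vecEnd_inducedMk, vecEnd_apply, LieModuleHom.map_lie]
  exact hM _ _

theorem koszulMap_comp_koszulAug {k l r : ℤ} (h : k = l + 1) (h' : l = r) :
    koszulMap L V S 0 h ≫ koszulAug L V S h' = 0 :=
  koszulMap_comp_eq_zero 0 h (M := evShift L V S r) (fun v m => vecEnd_evShift r v m) _

theorem epi_koszulAug {k r : ℤ} (h : k = r) : Epi (koszulAug L V S h) := by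
  refine GradedRep.epi_of_surjective _ fun x => ?_
  obtain ⟨s, rfl⟩ := (evShiftMk L V S r).surjective x
  obtain ⟨w, rfl⟩ := (exteriorZeroTensor_bijective (L := L) (V := V)).2 s
  exact ⟨_, lin_koszulAug_one h w⟩

/-- On a cycle of polynomial degree `i - l` the homotopy identity gives a boundary times `(i - l) +
(n + 1)`. This scalar is positive, since pieces of negative polynomial degree vanish. -/
theorem exact_koszulMap_koszulMap (n : ℕ) {k l m : ℤ} (h : k = l + 1) (h' : l = m + 1) :
    (ShortComplex.mk (koszulMap L V S (n + 1) h) (koszulMap L V S n h')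
      (koszulMap_comp_koszulMap n h h')).Exact := by
  refine GradedRep.exact_of_forall_piece _ _ _ fun i y hy hy0 => ?_
  obtain ⟨t, rfl⟩ := (inducedMk L l).surjective y
  rw [inducedMk_mem_iff] at hy
  rw [lin_koszulMap, LinearEquiv.map_eq_zero_iff] at hy0
  rcases lt_or_ge (i - l) 0 with hi | hi
  · rw [eq_zero_of_mem_polyTensorPiece_of_neg hi hy]
    exact ⟨0, by rw [map_zero, map_zero]⟩
  · have key := koszul_homotopy_identity n hy
    rw [hy0, map_zero, add_zero] at key
    have hc : (((i - l : ℤ) : ℂ) + ((n : ℂ) + 1)) ≠ 0 := by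
      have : ((i - l) + (n + 1) : ℤ) ≠ 0 := by omega
      exact_mod_cast this
    refine ⟨inducedMk L k ((((i - l : ℤ) : ℂ) + ((n : ℂ) + 1))⁻¹ •
      koszulHomotopy V S (n + 1) t), ?_⟩
    rw [lin_koszulMap, map_smul, key, smul_smul, inv_mul_cancel₀ hc, one_smul]

/-- In positive polynomial degree everything is a boundary by the homotopy. In degree zero its
scalar vanishes, but there the augmentation is injective. -/
theorem exact_koszulMap_koszulAug {k l r : ℤ} (h : k = l + 1) (h' : l = r) :
    (ShortComplex.mk (koszulMap L V S 0 h) (koszulAug L V S h')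
      (koszulMap_comp_koszulAug h h')).Exact := by
  refine GradedRep.exact_of_forall_piece _ _ _ fun i y hy hy0 => ?_
  obtain ⟨t, rfl⟩ := (inducedMk L l).surjective y
  rw [inducedMk_mem_iff] at hy
  rcases lt_trichotomy (i - l) 0 with hi | hi | hi
  · rw [eq_zero_of_mem_polyTensorPiece_of_neg hi hy]
    exact ⟨0, by rw [map_zero, map_zero]⟩
  · rw [hi] at hy
    obtain ⟨w, rfl⟩ := exists_eq_one_tmul_of_mem hy
    rw [lin_koszulAug_one, LinearEquiv.map_eq_zero_iff] at hy0
    have hw : w = 0 := (exteriorZeroTensor_bijective (L := L)).1 (hy0.trans (map_zero _).symm)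
    exact ⟨0, by rw [hw, TensorProduct.tmul_zero, map_zero, map_zero]⟩
  · have hc : ((i - l : ℤ) : ℂ) ≠ 0 := by exact_mod_cast hi.ne'
    refine ⟨inducedMk L k (((i - l : ℤ) : ℂ)⁻¹ • koszulHomotopy V S 0 t), ?_⟩
    rw [lin_koszulMap, map_smul, koszulLinear_koszulHomotopy_zero hy, smul_smul,
      inv_mul_cancel₀ hc, one_smul]

theorem add_natCast_zero (r : ℤ) : r + (0 : ℕ) = r := by simp

theorem add_natCast_succ (r : ℤ) (n : ℕ) : r + (n + 1 : ℕ) = r + n + 1 := by push_cast; ring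

variable (L V S) in
/-- The objects of the Koszul resolution of `S` placed in degree `r`, preceded by the resolved
module. -/
noncomputable def koszulObj (r : ℤ) : ℕ → GHat L V
  | 0 => evShift L V S r
  -- The differential trades one exterior factor for a variable of degree one, so it preserves
  -- degrees only if the generators `⋀ⁿ V ⊗ S` sit in degree `r + n`.
  | n + 1 => (inducedRep L V (⋀[ℂ]^n V ⊗[ℂ] S)).shift (r + n)

variable (L V S) in
/-- The differentials of the Koszul resolution, preceded by the augmentation. -/
noncomputable def koszulD (r : ℤ) : ∀ n, koszulObj L V S r (n + 1) ⟶ koszulObj L V S r n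
  | 0 => koszulAug L V S (add_natCast_zero r)
  | n + 1 => koszulMap L V S n (add_natCast_succ r n)

theorem koszulD_comp (r : ℤ) : ∀ n, koszulD L V S r (n + 1) ≫ koszulD L V S r n = 0
  | 0 => koszulMap_comp_koszulAug (add_natCast_succ r 0) (add_natCast_zero r)
  | n + 1 => koszulMap_comp_koszulMap n (add_natCast_succ r (n + 1)) (add_natCast_succ r n)

theorem exact_koszulD (r : ℤ) :
    ∀ n, (ShortComplex.mk _ _ (koszulD_comp (L := L) (V := V) (S := S) r n)).Exact
  | 0 => exact_koszulMap_koszulAug (add_natCast_succ r 0) (add_natCast_zero r)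
  | n + 1 => exact_koszulMap_koszulMap n (add_natCast_succ r (n + 1)) (add_natCast_succ r n)

/-- Extensions between concentrated graded modules, in terms of a single graded piece. -/
theorem nonempty_ext_evShift_linearEquiv [FiniteDimensional ℂ L] [LieAlgebra.IsSemisimple ℂ L]
    {T : Type u} [AddCommGroup T] [Module ℂ T] [LieRingModule L T] [LieModule ℂ L T]
    [FiniteDimensional ℂ T] (r s : ℤ) (j : ℕ) :
    Nonempty (Abelian.Ext (evShift L V S r) (evShift L V T s) j ≃ₗ[ℂ]
      ((⋀[ℂ]^j V ⊗[ℂ] S) →ₗ⁅ℂ, L⁆ (evShift L V T s).piece (r + j))) := by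
  have : Epi (koszulD L V S r 0) := epi_koszulAug (add_natCast_zero r)
  have : ∀ n, Projective (koszulObj L V S r (n + 1)) := fun n => projective_inducedRep _
  obtain ⟨e⟩ := Abelian.Ext.nonempty_linearEquiv_of_resolution (k := ℂ) (koszulD_comp r)
    (exact_koszulD (L := L) (V := V) (S := S) r) (Y := evShift L V T s)
    (fun n f => koszulMap_comp_eq_zero n (add_natCast_succ r n) (M := evShift L V T s)
      (fun v m => vecEnd_evShift s v m) f) j
  exact ⟨e.trans (inducedHomEquiv _ _ _)⟩

end KoszulComplex

theorem propositionP61 {g V : Type u} [LieRing g] [LieAlgebra ℂ g] [FiniteDimensional ℂ g]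
    [LieAlgebra.IsSemisimple ℂ g] (H : LieSubalgebra ℂ g) [H.IsCartanSubalgebra]
    (b : (LieAlgebra.IsKilling.rootSystem H).Base)
    [AddCommGroup V] [Module ℂ V] [LieRingModule g V] [LieModule ℂ g V] [FiniteDimensional ℂ V]
    (μ ν : Module.Dual ℂ H) (hμ : μ ∈ dominantWeights b) (hν : ν ∈ dominantWeights b)
    (Vμ Vν : Type u)
    [AddCommGroup Vμ] [Module ℂ Vμ] [LieRingModule g Vμ] [LieModule ℂ g Vμ]
    [FiniteDimensional ℂ Vμ] (hVμ : IsSimpleOfHighestWeight b μ Vμ)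
    [AddCommGroup Vν] [Module ℂ Vν] [LieRingModule g Vν] [LieModule ℂ g Vν]
    [FiniteDimensional ℂ Vν] (hVν : IsSimpleOfHighestWeight b ν Vν)
    (r s : ℤ) (j : ℕ) :
    ((j : ℤ) = s - r →
      Nonempty (Abelian.Ext (evShift g V Vμ r) (evShift g V Vν s) j ≃ₗ[ℂ]
        ((⋀[ℂ]^j V ⊗[ℂ] Vμ) →ₗ⁅ℂ, g⁆ Vν))) ∧
    ((j : ℤ) ≠ s - r →
      Subsingleton (Abelian.Ext (evShift g V Vμ r) (evShift g V Vν s) j)) := by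
  obtain ⟨e⟩ := nonempty_ext_evShift_linearEquiv (L := g) (V := V) (S := Vμ) (T := Vν) r s j
  -- The target is the piece of degree `r + j`, and `V(ν, s)` is concentrated in degree `s`.
  refine ⟨fun h => ⟨e.trans (evShiftHomEquiv V _ _ (by omega))⟩, fun h => ?_⟩
  have := subsingleton_hom_piece_evShift (L := g) (V := V) (S := Vν) (W := ⋀[ℂ]^j V ⊗[ℂ] Vμ)
    (k := r + j) (r := s) (by omega)
  exact e.toEquiv.subsingleton
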